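/- Let $n\ge 1$, let $\mathcal H=(\mathbb C^d)^{\otimes n}$ be the space of $n$ qudits, let $S_n$ act on $\mathcal H$ by permuting tensor factors, and let $\mathcal T\subset S_n$ be a set of transpositions that generates $S_n$; we write $\tau$ also for the operator on $\mathcal H$ given by $\tau\in\mathcal T$. Let $G_1,\dots,G_n$ be - ($\mathrm U(1)$ case, $d=2$) the Pauli matrices $Z_1,\dots,Z_n$; or - ($\mathrm{SU}(d)$ case) the Young–Jucys–Murphy elements $X_i=\sum_{j<i}(j,i)$ (so $X_1=0$). For $\beta=(\beta_r,\beta_{rs})_{1\le r\le s\le n}$ put $U_\beta=\exp\bigl(-i\bigl(\sum_r\beta_rG_r+\sum_{r\le s}\beta_{rs}G_rG_s\bigr)\bigr)$, and let $T_2=\mathbb E_\beta\bigl[U_\beta\otimes U_\beta\otimes\bar U_\beta\otimes\bar U_\beta\bigr]$, where the parameters are independent and uniform on $[0,2\pi]$. This is an operator on $\mathcal H^{\otimes4}\cong\mathrm{End}(\mathcal H^{\otimes 2})$ (the first two factors are kets, the last two are bras). Omitting tensor signs, define the modified CQA second moment operator and the Cayley moment operator by $$M_2=\frac1{|\mathcal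 T|}\sum_{\tau\in\mathcal T}T_2\,\tfrac18\bigl(6IIII+I\tau I\tau+\tau I\tau I+\tau II\tau+I\tau\tau I-II\tau\tau-\tau\tau II\bigr)\,T_2,$$ $$\mathrm{Cay}_2=\frac1{|\mathcal T|}\sum_{\tau\in\mathcal T}T_2\,\tfrac18\bigl(6IIII+\tau I\tau I+I\tau I\tau\bigr)\,T_2 .$$ Let $S^\lambda\subset\mathcal H$ be a sector with $\dim S^\lambda\ge2$, with the following orthonormal basis $(|a\rangle)_a$: - in the $\mathrm U(1)$ case, $S^\lambda$ is the span of the computational basis vectors with exactly $r$ entries equal to $0$, where $0<r<n$, and $(|a\rangle)$ consists of these vectors; - in the $\mathrm{SU}(d)$ case, $S^\lambda$ is a copy in $\mathcal H$ of the irreducible representation of $S_n$ of shape $\lambda\vdash n$, and $(|a\rangle)$ is its Young basis, that is, the orthonormal basis indexed by the standard Young tableaux of shape $\lambda$ in which the adjacent transpositions act by Young's orthogonal form. Write $E^a_b=|a\rangle\langle b|$ and $E^a_bE^c_d=E^a_b\otimes E^c_d=|a,c\rangle\langle b,d|\in(S^\lambda)^{\otimes4}$, and let $$S_{+-}=\mathrm{span}\bigl\{\tfrac12\bigl((E^a_aE^b_b-E^b_bE^a_a)-(E^a_bE^b_a-E^b_aE^a_b)\bigr):a\ne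 b\bigr\},$$ $$S_{-+}=\mathrm{span}\bigl\{\tfrac12\bigl((E^a_aE^b_b-E^b_bE^a_a)+(E^a_bE^b_a-E^b_aE^a_b)\bigr):a\ne b\bigr\}.$$ Then $S_{+-}\oplus S_{-+}$ is invariant under $M_2$, $(S^\lambda)^{\otimes4}$ is invariant under $\mathrm{Cay}_2$, and $$\lambda_1\bigl(M_2|_{S_{+-}\oplus S_{-+}}\bigr)\le\lambda_2\bigl(\mathrm{Cay}_2|_{(S^\lambda)^{\otimes4}}\bigr),$$ where $\lambda_k$ denotes the $k$-th largest eigenvalue, counted with multiplicity. -/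

import Mathlib

open scoped Kronecker

noncomputable section

namespace CQA

/-! ### Eigenvalues -/

/-- `eig k A` is the `k`-th largest eigenvalue (`k = 1, 2, …`) of an operator with real spectrum on
a finite-dimensional complex space, eigenvalues being repeated according to multiplicity. The roots
of the characteristic polynomial are listed in decreasing order. -/
def eig {V : Type*} [AddCommGroup V] [Module ℂ V] [FiniteDimensional ℂ V] (k : ℕ)
    (A : V →ₗ[ℂ] V) : ℝ :=
  ((A.charpoly.roots.map Complex.re).sort (· ≥ ·)).getD (k - 1) 0

/-! ### Operators on the fourfold tensor power

`X` labels an orthonormal basis of the Hilbert space `H`. The space `H ⊗ H ⊗ H ⊗ H` has coordinates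
in `(X × X) × (X × X)`; the first two factors carry kets, the last two factors carry bras, so that
it is identified with `End (H ⊗ H)`. -/

/-- Coordinates on the fourfold tensor power. -/
abbrev Quad (X : Type*) : Type _ := (X × X) × (X × X)

section Operators

variable {X : Type*} [Fintype X] [DecidableEq X]

/-- The fourfold tensor product `A ⊗ B ⊗ C ⊗ D` of operators. -/
def tensor4 (A B C D : Matrix X X ℂ) : Matrix (Quad X) (Quad X) ℂ :=
  (A ⊗ₖ B) ⊗ₖ (C ⊗ₖ D)

/-- Labels of the products of order at most two of `G 1, …, G n`: the first-order terms `G r`, and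
the second-order terms `G r * G s` with `r ≤ s`. -/
abbrev Label (n : ℕ) : Type := Fin n ⊕ {p : Fin n × Fin n // p.1 ≤ p.2}

/-- The Hamiltonian `∑ r, β r • G r + ∑ r ≤ s, β r s • G r * G s`. -/
def hamiltonian {n : ℕ} (G : Fin n → Matrix X X ℂ) (β : Label n → ℝ) : Matrix X X ℂ :=
  (∑ r : Fin n, (β (Sum.inl r) : ℂ) • G r) +
    ∑ p : {p : Fin n × Fin n // p.1 ≤ p.2}, (β (Sum.inr p) : ℂ) • (G p.1.1 * G p.1.2)

/-- The time evolution `exp (-i ∑ β G)`. -/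
def evolution {n : ℕ} (G : Fin n → Matrix X X ℂ) (β : Label n → ℝ) : Matrix X X ℂ :=
  NormedSpace.exp ((-Complex.I) • hamiltonian G β)

/-- The second moment operator `𝔼_β [U ⊗ U ⊗ Ū ⊗ Ū]` of `U = exp (-i ∑ β G)`, all parameters being
independent and uniform on `[0, 2π]`; the average is taken entrywise. -/
def moment2 {n : ℕ} (G : Fin n → Matrix X X ℂ) : Matrix (Quad X) (Quad X) ℂ :=
  Matrix.of fun p q =>
    ⨍ β in Set.pi Set.univ (fun _ : Label n => Set.Icc (0 : ℝ) (2 * Real.pi)),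
      tensor4 (evolution G β) (evolution G β)
        ((evolution G β).map (starRingEnd ℂ)) ((evolution G β).map (starRingEnd ℂ)) p q

/-- The modified second moment operator of a single SWAP `t`. -/
def modifiedSwap (t : Matrix X X ℂ) : Matrix (Quad X) (Quad X) ℂ :=
  (1 / 8 : ℂ) • ((6 : ℂ) • tensor4 1 1 1 1 + tensor4 1 t 1 t + tensor4 t 1 t 1 + tensor4 t 1 1 t
    + tensor4 1 t t 1 - tensor4 1 1 t t - tensor4 t t 1 1)

/-- The summand of the Cayley moment operator belonging to a single SWAP `t`. -/
def cayleySwap (t : Matrix X X ℂ) : Matrix (Quad X) (Quad X) ℂ :=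
  (1 / 8 : ℂ) • ((6 : ℂ) • tensor4 1 1 1 1 + tensor4 t 1 t 1 + tensor4 1 t 1 t)

/-- `|𝒯|⁻¹ ∑ τ ∈ 𝒯, T₂ * F (P τ) * T₂`, where `T₂` is the moment operator of `G` and `P τ` is the
operator of the permutation `τ`. -/
def conjugatedAverage {n : ℕ} (G : Fin n → Matrix X X ℂ) (P : Equiv.Perm (Fin n) → Matrix X X ℂ)
    (𝒯 : Finset (Equiv.Perm (Fin n)))
    (F : Matrix X X ℂ → Matrix (Quad X) (Quad X) ℂ) :
    EuclideanSpace ℂ (Quad X) →ₗ[ℂ] EuclideanSpace ℂ (Quad X) :=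
  Matrix.toEuclideanLin
    ((𝒯.card : ℂ)⁻¹ • ∑ τ ∈ 𝒯, moment2 G * F (P τ) * moment2 G)

/-- The modified CQA second moment operator. -/
def modifiedCQA {n : ℕ} (G : Fin n → Matrix X X ℂ) (P : Equiv.Perm (Fin n) → Matrix X X ℂ)
    (𝒯 : Finset (Equiv.Perm (Fin n))) :
    EuclideanSpace ℂ (Quad X) →ₗ[ℂ] EuclideanSpace ℂ (Quad X) :=
  conjugatedAverage G P 𝒯 modifiedSwap

/-- The Cayley moment operator. -/
def cayley {n : ℕ} (G : Fin n → Matrix X X ℂ) (P : Equiv.Perm (Fin n) → Matrix X X ℂ)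
    (𝒯 : Finset (Equiv.Perm (Fin n))) :
    EuclideanSpace ℂ (Quad X) →ₗ[ℂ] EuclideanSpace ℂ (Quad X) :=
  conjugatedAverage G P 𝒯 cayleySwap

end Operators

/-! ### Subspaces of the fourfold tensor power of a sector -/

section Subspaces

variable {X ι : Type*} [Fintype X]

/-- `unit2 e a b c d` is the vector of `E^a_b ⊗ E^c_d = |a, c⟩⟨b, d|`, where `E^a_b = |e a⟩⟨e b|`. -/
def unit2 (e : ι → EuclideanSpace ℂ X) (a b c d : ι) : EuclideanSpace ℂ (Quad X) :=
  WithLp.toLp 2 fun q =>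
    e a q.1.1 * e c q.1.2 * starRingEnd ℂ (e b q.2.1) * starRingEnd ℂ (e d q.2.2)

/-- The fourfold tensor power of the sector spanned by `e`. -/
def sector4 (e : ι → EuclideanSpace ℂ X) : Submodule ℂ (EuclideanSpace ℂ (Quad X)) :=
  Submodule.span ℂ {v | ∃ a b c d : ι, v = unit2 e a b c d}

/-- The off-diagonal subspace `S₊₋`. Exchanging `a` and `b` only changes the sign of the vector, so
`a ≠ b` may replace `a < b`. -/
def sPlusMinus (e : ι → EuclideanSpace ℂ X) : Submodule ℂ (EuclideanSpace ℂ (Quad X)) :=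
  Submodule.span ℂ {v | ∃ a b : ι, a ≠ b ∧
    v = (1 / 2 : ℂ) • ((unit2 e a a b b - unit2 e b b a a)
      - (unit2 e a b b a - unit2 e b a a b))}

/-- The off-diagonal subspace `S₋₊`. -/
def sMinusPlus (e : ι → EuclideanSpace ℂ X) : Submodule ℂ (EuclideanSpace ℂ (Quad X)) :=
  Submodule.span ℂ {v | ∃ a b : ι, a ≠ b ∧
    v = (1 / 2 : ℂ) • ((unit2 e a a b b - unit2 e b b a a)
      + (unit2 e a b b a - unit2 e b a a b))}

/-- The sum `S₊₋ ⊕ S₋₊`. -/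
def sOff (e : ι → EuclideanSpace ℂ X) : Submodule ℂ (EuclideanSpace ℂ (Quad X)) :=
  sPlusMinus e ⊔ sMinusPlus e

end Subspaces

/-! ### Systems of `n` qudits

`Fin n → Fin d` labels the computational basis of `(ℂ^d)^{⊗ n}`. -/

/-- The operator permuting the tensor factors: it sends `|x⟩` to `|x ∘ σ⁻¹⟩`. -/
def permOp (n d : ℕ) (σ : Equiv.Perm (Fin n)) : Matrix (Fin n → Fin d) (Fin n → Fin d) ℂ :=
  Matrix.of fun y x => if y = x ∘ ⇑σ⁻¹ then 1 else 0

/-- The Pauli matrix `Z` acting on the `r`-th qubit. -/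
def pauliZ (n : ℕ) (r : Fin n) : Matrix (Fin n → Fin 2) (Fin n → Fin 2) ℂ :=
  Matrix.diagonal fun x => if x r = 0 then 1 else -1

/-- The Young–Jucys–Murphy element `X_i = ∑ j < i, (j, i)` acting on `n` qudits. -/
def yjm (n d : ℕ) (i : Fin n) : Matrix (Fin n → Fin d) (Fin n → Fin d) ℂ :=
  ∑ j ∈ Finset.univ.filter (fun j => j < i), permOp n d (Equiv.swap j i)

/-- Bit strings of length `n` with exactly `r` entries equal to `0`. -/
abbrev ChargeString (n r : ℕ) : Type :=
  {x : Fin n → Fin 2 // (Finset.univ.filter fun i => x i = 0).card = r}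

/-- The computational basis of the `U(1)` charge sector with `r` entries equal to `0`. -/
def chargeBasis (n r : ℕ) (x : ChargeString n r) : EuclideanSpace ℂ (Fin n → Fin 2) :=
  EuclideanSpace.single x.1 1

/-- Standard Young tableaux of shape `μ` with entries `Fin n`: `cell i` is the (row, column)
position of the entry `i`, and entries increase along rows and columns. -/
structure StandardTableau (μ : YoungDiagram) (n : ℕ) where
  cell : Fin n ≃ {c : ℕ × ℕ // c ∈ μ.cells}
  row_lt : ∀ i j : Fin n,
    (cell i).1.1 = (cell j).1.1 → (cell i).1.2 < (cell j).1.2 → i < j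
  col_lt : ∀ i j : Fin n,
    (cell i).1.2 = (cell j).1.2 → (cell i).1.1 < (cell j).1.1 → i < j

/-- The content (column minus row) of the box holding `i`. -/
def StandardTableau.content {μ : YoungDiagram} {n : ℕ} (T : StandardTableau μ n) (i : Fin n) : ℤ :=
  ((T.cell i).1.2 : ℤ) - ((T.cell i).1.1 : ℤ)

/-- `e` is the Young basis of a copy of the irreducible representation `S^μ` of `S_n` in
`(ℂ^d)^{⊗ n}`: an orthonormal family labelled by the standard tableaux of shape `μ`, on which each
adjacent transposition `(i, i + 1)` acts by Young's orthogonal form. When the axial distance is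
`± 1` exchanging `i` and `i + 1` does not give a standard tableau; otherwise it does. -/
def IsYoungBasis {μ : YoungDiagram} {n d : ℕ}
    (e : StandardTableau μ n → EuclideanSpace ℂ (Fin n → Fin d)) : Prop :=
  Orthonormal ℂ e ∧
  ∀ i j : Fin n, (j : ℕ) = (i : ℕ) + 1 → ∀ T : StandardTableau μ n,
    (|T.content j - T.content i| = 1 →
      Matrix.toEuclideanLin (permOp n d (Equiv.swap i j)) (e T)
        = (1 / ((T.content j - T.content i : ℤ) : ℂ)) • e T) ∧
    (∀ T' : StandardTableau μ n, T'.cell = (Equiv.swap i j).trans T.cell →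
      Matrix.toEuclideanLin (permOp n d (Equiv.swap i j)) (e T)
        = (1 / ((T.content j - T.content i : ℤ) : ℂ)) • e T
          + ((√(1 - 1 / ((T.content j - T.content i : ℤ) : ℝ) ^ 2) : ℝ) : ℂ) • e T')

end CQA

end

noncomputable section

open scoped Matrix

namespace CQA

/-! ### Eigenvalues -/

/-! On the sector the generators are diagonal with integer eigenvalues, so averaging over whole
periods makes T₂ the projection onto the coordinates |a,c⟩⟨b,d| whose phase vanishes for every β.
First- and second-order terms together determine the unordered pair of labels
(`quadValue_eq_zero_iff`), so exactly the E^a_aE^c_c and E^a_cE^c_a survive (`moment2_mul_quadMap`).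

For a function x on pairs of labels, `dvec x` and `ovec x` are the combinations of these two
families. A SWAP restricts to a Hermitian involution t, so the numbers t_ab t_ba = |t_ab|² are
transition probabilities, and the compressed Cayley term acts on every `dvec x` as a lazy walk
moving one of the two labels. The four additional terms of the modified operator cancel on
antisymmetric x, which gives the same walk on `dvec x` and, by exchanging the bras, on `ovec x`
(`sectorModified_mulVec_dvec`, `sectorModified_mulVec_ovec`).

By `mem_sOff_iff`, M₂ on S₊₋ ⊕ S₋₊ is therefore two copies of the averaged walk on antisymmetric
functions, while Cay₂ contains this walk on all functions. The walk fixes constants and contracts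
the sup norm. Hence each eigenvalue of M₂ has modulus at most 1 and is an eigenvalue of Cay₂ with an
eigenvector independent of the constant one, so `eig_one_le_eig_two` applies. For SU(d) the joint
eigenvalues are the contents (`IsYoungBasis.yjm_apply`), which separate tableaux
(`StandardTableau.content_injective`). -/

theorem le_getD_one_of_cons_le {l : List ℝ} (hl : l.Pairwise (· ≥ ·)) {w : ℝ} (hw : w ≤ 1)
    (h : ({1, w} : Multiset ℝ) ≤ (l : Multiset ℝ)) : w ≤ l.getD 1 0 := by
  have hc : 2 ≤ (l : Multiset ℝ).countP (fun x => w ≤ x) := by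
    refine le_trans ?_ (Multiset.countP_le_of_le _ h)
    simp [Multiset.insert_eq_cons, hw, ← Multiset.cons_zero]
  match l, hl with
  | [], _ => simp at hc
  | [a], _ =>
    have := List.countP_le_length (p := fun x => decide (w ≤ x)) (l := [a])
    simp only [Multiset.coe_countP] at hc
    simp only [List.length_singleton] at this
    omega
  | a :: b :: l, hl =>
    by_contra hb
    simp only [List.getD_cons_succ, List.getD_cons_zero, not_le] at hb
    rw [List.pairwise_cons, List.pairwise_cons] at hl
    -- If the second entry were below `w`, sortedness would leave only the head to be counted.
    have hz : (b :: l).countP (fun x => decide (w ≤ x)) = 0 := by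
      rw [List.countP_eq_zero]
      intro x hx
      rcases List.mem_cons.1 hx with rfl | hx
      · simpa using hb
      · simpa using lt_of_le_of_lt (hl.2.1 x hx) hb
    simp only [Multiset.coe_countP, List.countP_cons, hz] at hc
    split_ifs at hc <;> simp_all

/-- Geometric multiplicity is at most algebraic multiplicity, so 1 and `z` are two roots for `B`
counted with multiplicity. It is not necessary that 1 be the largest; `z.re ≤ 1` is enough. -/
theorem eig_one_le_eig_two {V W : Type*} [AddCommGroup V] [Module ℂ V] [FiniteDimensional ℂ V]
    [AddCommGroup W] [Module ℂ W] [FiniteDimensional ℂ W] [Nontrivial V]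
    (A : V →ₗ[ℂ] V) (B : W →ₗ[ℂ] W) (w₀ : W) (hw₀ : B w₀ = w₀)
    (h : ∀ (z : ℂ) (v : V), v ≠ 0 → A v = z • v → z.re ≤ 1 ∧
      ∃ w, B w = z • w ∧ LinearIndependent ℂ ![w₀, w]) :
    eig 1 A ≤ eig 2 B := by
  set R := A.charpoly.roots.map Complex.re with hR
  -- A nonzero complex space has an eigenvalue, so the default value 0 in `eig 1 A` is never taken.
  have hR0 : R ≠ 0 := by
    obtain ⟨z, hz⟩ := Module.End.exists_eigenvalue A
    rw [Module.End.hasEigenvalue_iff_isRoot_charpoly] at hz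
    have : z ∈ A.charpoly.roots := (Polynomial.mem_roots A.charpoly_monic.ne_zero).2 hz
    intro h0
    have := Multiset.mem_map_of_mem Complex.re this
    rw [← hR, h0] at this
    simp at this
  have hmem : eig 1 A ∈ R := by
    unfold eig
    rw [← hR]
    have hl : R.sort (· ≥ ·) ≠ [] := by
      intro h0
      apply hR0
      rw [← Multiset.sort_eq R (· ≥ ·), h0]; rfl
    obtain ⟨a, l, hal⟩ := List.exists_cons_of_ne_nil hl
    rw [← Multiset.mem_sort (r := (· ≥ ·)), hal]
    simp
  obtain ⟨z, hz, hzre⟩ := Multiset.mem_map.1 hmem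
  rw [← hzre]
  have hzroot := (Polynomial.mem_roots A.charpoly_monic.ne_zero).1 hz
  rw [← Module.End.hasEigenvalue_iff_isRoot_charpoly] at hzroot
  obtain ⟨v, hv⟩ := hzroot.exists_hasEigenvector
  obtain ⟨hz1, w, hw, hli⟩ := h z v hv.2 hv.apply_eq_smul
  refine le_getD_one_of_cons_le (Multiset.pairwise_sort _ _) hz1 ?_
  rw [Multiset.sort_eq]
  have h1z : ({1, z} : Multiset ℂ) ≤ B.charpoly.roots := by
    have hw0 : w ≠ 0 := hli.ne_zero 1
    have hw00 : w₀ ≠ 0 := hli.ne_zero 0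
    rw [Multiset.le_iff_count]
    intro y
    rw [Polynomial.count_roots]
    refine le_trans ?_ (LinearMap.finrank_eigenspace_le B y)
    have key1 : (Module.End.eigenspace B y ≠ ⊥) → 1 ≤ Module.finrank ℂ (Module.End.eigenspace B y) :=
      fun hne => Submodule.one_le_finrank_iff.2 hne
    have hwz : w ∈ Module.End.eigenspace B z := Module.End.mem_eigenspace_iff.2 hw
    have hw1 : w₀ ∈ Module.End.eigenspace B 1 := Module.End.mem_eigenspace_iff.2 (by simpa using hw₀)
    have hne {z : ℂ} {w : W} (h0 : w ≠ 0) (hm : w ∈ Module.End.eigenspace B z) :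
        Module.End.eigenspace B z ≠ ⊥ := fun hb => h0 (by simpa [hb] using hm)
    -- Only for `z = 1` is independence of `w₀` and `w` needed: the eigenspace must then have
    -- dimension at least 2.
    by_cases hz1 : z = 1
    · subst hz1
      by_cases hy : y = 1
      · subst hy
        have : Submodule.span ℂ (Set.range ![w₀, w]) ≤ Module.End.eigenspace B 1 := by
          rw [Submodule.span_le]
          rintro _ ⟨i, rfl⟩
          fin_cases i
          · exact hw1
          · exact hwz
        have h2 := Submodule.finrank_mono this
        rw [finrank_span_eq_card hli] at h2
        simpa [Multiset.insert_eq_cons] using h2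
      · simp [Multiset.insert_eq_cons, hy]
    · by_cases hy : y = 1
      · subst hy
        simpa [Multiset.insert_eq_cons, Multiset.count_singleton, Ne.symm hz1] using key1 (hne hw00 hw1)
      · by_cases hyz : y = z
        · subst hyz
          simpa [Multiset.insert_eq_cons, Multiset.count_cons, Multiset.count_singleton, hy]
            using key1 (hne hw0 hwz)
        · simp [Multiset.insert_eq_cons, hy, hyz]
  simpa [Multiset.insert_eq_cons] using Multiset.map_le_map (f := Complex.re) h1z

/-! ### Averages of phases -/

theorem setAverage_exp_int_mul (k : ℤ) :
    ⨍ x in Set.Icc (0 : ℝ) (2 * Real.pi), Complex.exp (-Complex.I * (x * k)) =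
      if k = 0 then 1 else 0 := by
  have hpi := Real.pi_pos
  rw [MeasureTheory.setAverage_eq, MeasureTheory.integral_Icc_eq_integral_Ioc,
    ← intervalIntegral.integral_of_le (by positivity)]
  have hvol : MeasureTheory.volume.real (Set.Icc (0 : ℝ) (2 * Real.pi)) = 2 * Real.pi := by
    rw [Real.volume_real_Icc]; simp [hpi.le]
  split_ifs with hk
  · subst hk
    rw [hvol]
    have : (Real.pi : ℂ) ≠ 0 := by exact_mod_cast hpi.ne'
    simp
    field_simp
  · have h : (-Complex.I * k) ≠ 0 := by simp [hk]
    have : ∀ x : ℝ, Complex.exp (-Complex.I * (x * k)) = Complex.exp ((-Complex.I * k) * x) :=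
      fun x => by ring_nf
    simp_rw [this]
    rw [integral_exp_mul_complex h]
    have : Complex.exp (-Complex.I * k * ((2 * Real.pi : ℝ) : ℂ)) = 1 := by
      rw [Complex.exp_eq_one_iff]
      exact ⟨-k, by push_cast; ring⟩
    rw [this]
    simp

theorem setAverage_exp_sum_int_mul {L : Type*} [Fintype L] (k : L → ℤ) :
    ⨍ β in Set.pi Set.univ (fun _ : L => Set.Icc (0 : ℝ) (2 * Real.pi)),
      Complex.exp (-Complex.I * ∑ l, (β l : ℂ) * k l) = if k = 0 then 1 else 0 := by
  rw [MeasureTheory.setAverage_eq, MeasureTheory.volume_pi, MeasureTheory.Measure.restrict_pi_pi]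
  simp_rw [Finset.mul_sum, Complex.exp_sum]
  rw [MeasureTheory.integral_fintype_prod_eq_prod
    (fun l (x : ℝ) => Complex.exp (-Complex.I * (x * k l)))]
  have : (MeasureTheory.Measure.pi fun _ : L => MeasureTheory.volume).real
      (Set.pi Set.univ (fun _ : L => Set.Icc (0 : ℝ) (2 * Real.pi))) =
      ∏ _l : L, MeasureTheory.volume.real (Set.Icc (0 : ℝ) (2 * Real.pi)) := by
    simp only [MeasureTheory.Measure.real, MeasureTheory.Measure.pi_pi, ENNReal.toReal_prod]
  rw [this, ← Finset.prod_inv_distrib, Complex.real_smul, Complex.ofReal_prod,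
    ← Finset.prod_mul_distrib]
  have h1 := fun l => setAverage_exp_int_mul (k l)
  simp_rw [MeasureTheory.setAverage_eq, Complex.real_smul] at h1
  simp_rw [h1, Finset.prod_ite_zero, Finset.prod_const_one]
  simp [funext_iff]

/-! ### Intertwining -/

section Intertwining

variable {X ι : Type*} [Fintype X] [DecidableEq X] [Fintype ι] [DecidableEq ι]

/-- The powers intertwine, and multiplication by `E` is continuous, so the two exponential series
agree termwise. -/
theorem exp_mul_of_intertwine {A : Matrix X X ℂ} {B : Matrix ι ι ℂ} {E : Matrix X ι ℂ}
    (h : A * E = E * B) : NormedSpace.exp A * E = E * NormedSpace.exp B := by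
  have hA : HasSum (fun n : ℕ => ((n.factorial : ℂ)⁻¹) • A ^ n) (NormedSpace.exp A) :=
    open scoped Matrix.Norms.Operator in NormedSpace.exp_series_hasSum_exp' A
  have hB : HasSum (fun n : ℕ => ((n.factorial : ℂ)⁻¹) • B ^ n) (NormedSpace.exp B) :=
    open scoped Matrix.Norms.Operator in NormedSpace.exp_series_hasSum_exp' B
  replace hA := hA.map (Matrix.addMonoidHomMulRight E) (continuous_id.matrix_mul continuous_const)
  replace hB := hB.map (Matrix.addMonoidHomMulLeft E) (continuous_const.matrix_mul continuous_id)
  have hpow : ∀ n : ℕ, A ^ n * E = E * B ^ n := by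
    intro n
    induction n with
    | zero => simp
    | succ n ih => rw [pow_succ, Matrix.mul_assoc, h, ← Matrix.mul_assoc, ih, Matrix.mul_assoc,
        ← pow_succ]
  refine hA.unique ?_
  convert hB using 1
  swap
  · rfl
  funext n
  change ((n.factorial : ℂ)⁻¹ • A ^ n) * E = E * ((n.factorial : ℂ)⁻¹ • B ^ n)
  rw [Matrix.smul_mul, Matrix.mul_smul, hpow]

end Intertwining

/-! ### The second moment operator on a sector is a projection. -/

section Moment

variable {X ι : Type*}

/-- The fourfold tensor power of an isometry: `E ⊗ E` on kets, its complex conjugate on bras. -/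
def quadMap (E : Matrix X ι ℂ) : Matrix (Quad X) (Quad ι) ℂ :=
  (E ⊗ₖ E) ⊗ₖ (E.map (starRingEnd ℂ) ⊗ₖ E.map (starRingEnd ℂ))

/-- On bras `quadMap` uses the conjugate of `E`, so the hypotheses there concern conjugated
operators. -/
theorem tensor4_mul_quadMap [Fintype X] [Fintype ι]
    {A B C D : Matrix X X ℂ} {a b c d : Matrix ι ι ℂ} {E : Matrix X ι ℂ}
    (hA : A * E = E * a) (hB : B * E = E * b)
    (hC : C.map (starRingEnd ℂ) * E = E * c.map (starRingEnd ℂ))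
    (hD : D.map (starRingEnd ℂ) * E = E * d.map (starRingEnd ℂ)) :
    tensor4 A B C D * quadMap E = quadMap E * tensor4 a b c d := by
  have hconj : ∀ {C : Matrix X X ℂ} {c : Matrix ι ι ℂ},
      C.map (starRingEnd ℂ) * E = E * c.map (starRingEnd ℂ) →
      C * E.map (starRingEnd ℂ) = E.map (starRingEnd ℂ) * c := by
    intro C c h
    have := congrArg (fun M => M.map (starRingEnd ℂ)) h
    simp only [Matrix.map_mul, Matrix.map_map] at this
    simpa [Function.comp_def] using this
  unfold tensor4 quadMap
  simp only [← Matrix.mul_kronecker_mul, hA, hB, hconj hC, hconj hD]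

/-- The joint eigenvalues of the products labelled by `Label n`. -/
def labelValue {n : ℕ} (g : Fin n → ι → ℤ) (a : ι) : Label n → ℤ :=
  Sum.elim (fun r => g r a) (fun p => g p.1.1 a * g p.1.2 a)

/-- The phase of a coordinate vector under `U ⊗ U ⊗ Ū ⊗ Ū`. -/
def quadValue {n : ℕ} (g : Fin n → ι → ℤ) (q : Quad ι) (l : Label n) : ℤ :=
  labelValue g q.1.1 l + labelValue g q.1.2 l - labelValue g q.2.1 l - labelValue g q.2.2 l

/-- The coordinate vectors fixed by the moment operator. -/
def IsPaired (q : Quad ι) : Prop := q.1 = q.2 ∨ q.1 = q.2.swap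

instance [DecidableEq ι] : DecidablePred (IsPaired : Quad ι → Prop) := fun _ => by unfold IsPaired; infer_instance

/-- Eliminating c through g(c) = g(b) + g(d) − g(a) turns the quadratic relations into the vanishing
of the symmetric product of g(a) − g(b) and g(a) − g(d). One factor must then vanish, and
injectivity identifies the labels. -/
theorem quadValue_eq_zero_iff {n : ℕ} {g : Fin n → ι → ℤ}
    (hg : Function.Injective fun a r => g r a) (q : Quad ι) : quadValue g q = 0 ↔ IsPaired q := by
  obtain ⟨⟨a, c⟩, b, d⟩ := q
  constructor
  · intro h
    have h1 : ∀ r, g r a + g r c = g r b + g r d := by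
      intro r
      have := congrFun h (Sum.inl r)
      simp [quadValue, labelValue] at this
      linarith
    have h2' : ∀ r s, r ≤ s →
        g r a * g s a + g r c * g s c = g r b * g s b + g r d * g s d := by
      intro r s hrs
      have := congrFun h (Sum.inr ⟨(r, s), hrs⟩)
      simp [quadValue, labelValue] at this
      linarith
    have h2 : ∀ r s, g r a * g s a + g r c * g s c = g r b * g s b + g r d * g s d := by
      intro r s
      rcases le_total r s with hrs | hrs
      · exact h2' r s hrs
      · have := h2' s r hrs
        linarith
    have h3 : ∀ r s, (g r a - g r b) * (g s a - g s d) + (g s a - g s b) * (g r a - g r d) = 0 := by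
      intro r s
      have e1 := h1 r
      have e2 := h1 s
      have e3 := h2 r s
      obtain hx : g r c = g r b + g r d - g r a := by linarith
      obtain hy : g s c = g s b + g s d - g s a := by linarith
      rw [hx, hy] at e3
      linarith
    have h4 : a = b ∨ a = d := by
      by_contra hne
      push Not at hne
      obtain ⟨r, hr⟩ := Function.ne_iff.1 (hg.ne hne.1)
      obtain ⟨s, hs⟩ := Function.ne_iff.1 (hg.ne hne.2)
      have hr' : g r a - g r b ≠ 0 := sub_ne_zero.2 hr
      have hs' : g s a - g s d ≠ 0 := sub_ne_zero.2 hs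
      have err := h3 r r
      have ess := h3 s s
      have ers := h3 r s
      -- The diagonal entry at `r` kills one factor; the mixed entry `(r, s)` then reduces to a
      -- product of nonzero integers.
      have hrd : g r a - g r d = 0 := by
        have : (g r a - g r b) * (g r a - g r d) = 0 := by linarith
        exact (mul_eq_zero.1 this).resolve_left hr'
      rw [hrd] at ers
      simp [hr', hs'] at ers
    rcases h4 with rfl | rfl
    · left
      have : c = d := hg (funext fun r => by have := h1 r; simp only; linarith)
      rw [this]
    · right
      have : c = b := hg (funext fun r => by have := h1 r; simp only; linarith)
      rw [this]; rfl
  · rintro (h | h) <;> (simp only [Prod.mk.injEq, Prod.swap_prod_mk] at h; obtain ⟨rfl, rfl⟩ := h) <;>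
      (ext l; simp [quadValue])

/-- The projection onto the coordinate vectors fixed by the moment operator. -/
def pairedProj (ι : Type*) [DecidableEq ι] : Matrix (Quad ι) (Quad ι) ℂ :=
  Matrix.diagonal fun q => if IsPaired q then 1 else 0

variable [Fintype X] [Fintype ι] [DecidableEq ι]

theorem hamiltonian_mul {n : ℕ} {G : Fin n → Matrix X X ℂ} {E : Matrix X ι ℂ} {g : Fin n → ι → ℤ}
    (hG : ∀ r, G r * E = E * Matrix.diagonal fun a => (g r a : ℂ)) (β : Label n → ℝ) :
    hamiltonian G β * E =
      E * Matrix.diagonal fun a => ∑ l, (β l : ℂ) * (labelValue g a l : ℂ) := by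
  have hGG : ∀ r s, G r * G s * E = E * Matrix.diagonal fun a => ((g r a * g s a : ℤ) : ℂ) := by
    intro r s
    rw [Matrix.mul_assoc, hG, ← Matrix.mul_assoc, hG, Matrix.mul_assoc, Matrix.diagonal_mul_diagonal]
    push_cast; rfl
  unfold hamiltonian
  rw [Matrix.add_mul, Matrix.sum_mul, Matrix.sum_mul]
  simp_rw [Matrix.smul_mul, hG, hGG]
  ext x a
  simp [Matrix.sum_apply, labelValue, Fintype.sum_sum_type, Matrix.mul_diagonal, mul_add,
    Finset.mul_sum, mul_left_comm]

variable [DecidableEq X]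

theorem evolution_mul {n : ℕ} {G : Fin n → Matrix X X ℂ} {E : Matrix X ι ℂ} {g : Fin n → ι → ℤ}
    (hG : ∀ r, G r * E = E * Matrix.diagonal fun a => (g r a : ℂ)) (β : Label n → ℝ) :
    evolution G β * E = E * Matrix.diagonal fun a =>
      Complex.exp (-Complex.I * ∑ l, (β l : ℂ) * (labelValue g a l : ℂ)) := by
  have h : (-Complex.I • hamiltonian G β) * E = E * Matrix.diagonal
      (fun a => -Complex.I * ∑ l, (β l : ℂ) * (labelValue g a l : ℂ)) := by
    rw [Matrix.smul_mul, hamiltonian_mul hG, ← Matrix.mul_smul, ← Matrix.diagonal_smul]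
    rfl
  rw [evolution, exp_mul_of_intertwine h, Matrix.exp_diagonal]
  congr 2
  ext a
  rw [Pi.coe_exp, Complex.exp_eq_exp_ℂ]

theorem continuous_evolution {n : ℕ} (G : Fin n → Matrix X X ℂ) : Continuous (evolution G) := by
  have hexp : Continuous (NormedSpace.exp : Matrix X X ℂ → Matrix X X ℂ) :=
    open scoped Matrix.Norms.Operator in NormedSpace.exp_continuous
  refine hexp.comp ?_
  unfold hamiltonian
  fun_prop

theorem tensor4_evolution_mul {n : ℕ} {G : Fin n → Matrix X X ℂ} {E : Matrix X ι ℂ}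
    {g : Fin n → ι → ℤ} (hG : ∀ r, G r * E = E * Matrix.diagonal fun a => (g r a : ℂ))
    (β : Label n → ℝ) :
    tensor4 (evolution G β) (evolution G β) ((evolution G β).map (starRingEnd ℂ))
        ((evolution G β).map (starRingEnd ℂ)) * quadMap E =
      quadMap E * Matrix.diagonal fun q =>
        Complex.exp (-Complex.I * ∑ l, (β l : ℂ) * (quadValue g q l : ℂ)) := by
  have h := evolution_mul hG β
  set D : Matrix ι ι ℂ := Matrix.diagonal fun a =>
      Complex.exp (-Complex.I * ∑ l, (β l : ℂ) * (labelValue g a l : ℂ)) with hD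
  have h' : ((evolution G β).map (starRingEnd ℂ)).map (starRingEnd ℂ) * E =
      E * (D.map (starRingEnd ℂ)).map (starRingEnd ℂ) := by
    simpa [Matrix.map_map, Function.comp_def] using h
  rw [tensor4_mul_quadMap h h h' h']
  congr 1
  rw [hD, Matrix.diagonal_map (map_zero _)]
  unfold tensor4
  simp only [Matrix.diagonal_kronecker_diagonal]
  congr 1
  ext q
  simp only [← Complex.exp_conj, ← Complex.exp_add, map_mul, map_neg, Complex.conj_I, map_sum,
    Complex.conj_ofReal, map_intCast]
  congr 1
  simp only [quadValue]
  push_cast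
  simp only [mul_sub, mul_add, Finset.sum_sub_distrib, Finset.sum_add_distrib]
  ring

/-- Each coordinate vector of the sector only acquires a phase, whose average is 1 or 0. Continuity
on the compact parameter box justifies exchanging the finite sum with the integral. -/
theorem moment2_mul_quadMap {n : ℕ} {G : Fin n → Matrix X X ℂ} {E : Matrix X ι ℂ}
    {g : Fin n → ι → ℤ} (hG : ∀ r, G r * E = E * Matrix.diagonal fun a => (g r a : ℂ))
    (hg : Function.Injective fun a r => g r a) :
    moment2 G * quadMap E =
      quadMap E * pairedProj ι := by
  ext p q
  set S : Set (Label n → ℝ) := Set.pi Set.univ (fun _ : Label n => Set.Icc (0 : ℝ) (2 * Real.pi))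
  have hint : ∀ k, MeasureTheory.IntegrableOn (fun β => tensor4 (evolution G β) (evolution G β)
        ((evolution G β).map (starRingEnd ℂ)) ((evolution G β).map (starRingEnd ℂ)) p k) S := by
    intro k
    refine ContinuousOn.integrableOn_compact (isCompact_univ_pi fun _ => isCompact_Icc)
      (Continuous.continuousOn ?_)
    have := continuous_evolution G
    have hc : ∀ x y, Continuous fun β => evolution G β x y := fun x y =>
      (continuous_apply y).comp ((continuous_apply x).comp this)
    simp only [tensor4, Matrix.kroneckerMap_apply, Matrix.map_apply]
    exact ((hc _ _).mul (hc _ _)).mul ((Complex.continuous_conj.comp (hc _ _)).mul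
      (Complex.continuous_conj.comp (hc _ _)))
  simp only [Matrix.mul_apply, moment2, Matrix.of_apply, MeasureTheory.setAverage_eq]
  simp_rw [smul_mul_assoc, ← MeasureTheory.integral_mul_const]
  rw [← Finset.smul_sum, ← MeasureTheory.integral_finsetSum _ fun k _ => (hint k).mul_const _]
  have h1 : ∀ β, ∑ k, tensor4 (evolution G β) (evolution G β)
        ((evolution G β).map (starRingEnd ℂ)) ((evolution G β).map (starRingEnd ℂ)) p k *
          quadMap E k q =
      quadMap E p q * Complex.exp (-Complex.I * ∑ l, (β l : ℂ) * (quadValue g q l : ℂ)) := by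
    intro β
    rw [← Matrix.mul_apply, tensor4_evolution_mul hG, Matrix.mul_diagonal]
  simp_rw [h1]
  rw [MeasureTheory.integral_const_mul, ← mul_smul_comm, ← MeasureTheory.setAverage_eq,
    setAverage_exp_sum_int_mul]
  simp only [quadValue_eq_zero_iff hg, pairedProj, Matrix.mul_diagonal, ← Matrix.mul_apply]

end Moment

/-! ### Random walks on pairs of basis labels. -/

section Walk

variable {ι : Type*} [Fintype ι] [DecidableEq ι]

/-- The modified second moment operator of a SWAP with matrix `t` on kets and `tᵀ` on bras. -/
def sectorModified (t : Matrix ι ι ℂ) : Matrix (Quad ι) (Quad ι) ℂ :=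
  (1 / 8 : ℂ) • ((6 : ℂ) • tensor4 1 1 1 1 + tensor4 1 t 1 tᵀ + tensor4 t 1 tᵀ 1
    + tensor4 t 1 1 tᵀ + tensor4 1 t tᵀ 1 - tensor4 1 1 tᵀ tᵀ - tensor4 t t 1 1)

/-- The Cayley moment operator of a SWAP with matrix `t` on kets and `tᵀ` on bras. -/
def sectorCayley (t : Matrix ι ι ℂ) : Matrix (Quad ι) (Quad ι) ℂ :=
  (1 / 8 : ℂ) • ((6 : ℂ) • tensor4 1 1 1 1 + tensor4 t 1 tᵀ 1 + tensor4 1 t 1 tᵀ)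

/-- The vector `∑ a c, x (a, c) • E^a_a E^c_c`. -/
def dvec : (ι × ι → ℂ) →ₗ[ℂ] (Quad ι → ℂ) where
  toFun x q := if q.1 = q.2 then x q.1 else 0
  map_add' x y := by ext q; simp only [Pi.add_apply]; split_ifs <;> simp
  map_smul' c x := by ext q; simp

/-- The vector `∑ a c, x (a, c) • E^a_c E^c_a`. -/
def ovec : (ι × ι → ℂ) →ₗ[ℂ] (Quad ι → ℂ) where
  toFun x q := if q.1 = q.2.swap then x q.1 else 0
  map_add' x y := by ext q; simp only [Pi.add_apply]; split_ifs <;> simp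
  map_smul' c x := by ext q; simp

/-- One step of the lazy random walk on pairs whose transition probabilities are
`t a b * t b a`. -/
def walk (t : Matrix ι ι ℂ) : (ι × ι → ℂ) →ₗ[ℂ] (ι × ι → ℂ) where
  toFun x p := (1 / 8 : ℂ) * (6 * x p + ∑ b, t p.1 b * t b p.1 * x (b, p.2)
    + ∑ b, t p.2 b * t b p.2 * x (p.1, b))
  map_add' x y := by
    ext p; simp only [Pi.add_apply, mul_add, Finset.sum_add_distrib]; ring
  map_smul' c x := by
    ext p
    simp only [Pi.smul_apply, smul_eq_mul, RingHom.id_apply, mul_left_comm _ c, ← Finset.mul_sum]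
    ring

/-- Antisymmetric functions on pairs. -/
def antisymm (ι : Type*) : Submodule ℂ (ι × ι → ℂ) where
  carrier := {x | ∀ a b, x (b, a) = -x (a, b)}
  add_mem' hx hy a b := by simp only [Pi.add_apply, hx a b, hy a b]; ring
  zero_mem' a b := by simp
  smul_mem' c x hx a b := by simp [hx a b]

omit [Fintype ι] [DecidableEq ι] in
theorem antisymm_diag {x : ι × ι → ℂ} (hx : x ∈ antisymm ι) (a : ι) : x (a, a) = 0 := by
  have := hx a a
  exact self_eq_neg.1 this

omit [DecidableEq ι] in
theorem walk_mem_antisymm (t : Matrix ι ι ℂ) {x : ι × ι → ℂ} (hx : x ∈ antisymm ι) :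
    walk t x ∈ antisymm ι := by
  intro a b
  simp only [walk, LinearMap.coe_mk, AddHom.coe_mk]
  simp_rw [hx a b, fun c => hx a c, fun c => hx c b]
  simp only [mul_neg, Finset.sum_neg_distrib]
  ring

theorem mulVec_dvec (F : Matrix (Quad ι) (Quad ι) ℂ) (x : ι × ι → ℂ) (p : Quad ι) :
    (F.mulVec (dvec x)) p = ∑ a, ∑ c, F p ((a, c), (a, c)) * x (a, c) := by
  simp only [Matrix.mulVec, dotProduct, Fintype.sum_prod_type (f := fun q : Quad ι => _), dvec,
    LinearMap.coe_mk, AddHom.coe_mk]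
  simp [Fintype.sum_prod_type]

omit [Fintype ι] [DecidableEq ι] in
theorem tensor4_apply (A B C D : Matrix ι ι ℂ) (p q : Quad ι) :
    tensor4 A B C D p q = A p.1.1 q.1.1 * B p.1.2 q.1.2 * (C p.2.1 q.2.1 * D p.2.2 q.2.2) := rfl

theorem pairedProj_mulVec (v : Quad ι → ℂ) (p : Quad ι) :
    (pairedProj ι).mulVec v p = if IsPaired p then v p else 0 := by
  simp [pairedProj, Matrix.mulVec_diagonal]

theorem pairedProj_mulVec_dvec (x : ι × ι → ℂ) : (pairedProj ι).mulVec (dvec x) = dvec x := by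
  ext p
  rw [pairedProj_mulVec]
  simp only [dvec, LinearMap.coe_mk, AddHom.coe_mk, IsPaired]
  split_ifs <;> simp_all

/-- No entry reaches |a,c⟩⟨c,a| with a ≠ c: each term has an identity on a ket and on its matching
bra, which forces a = c. -/
theorem sectorCayley_mulVec_dvec (t : Matrix ι ι ℂ) (x : ι × ι → ℂ) :
    (pairedProj ι * sectorCayley t * pairedProj ι).mulVec (dvec x) = dvec (walk t x) := by
  rw [← Matrix.mulVec_mulVec, pairedProj_mulVec_dvec, ← Matrix.mulVec_mulVec]
  ext p
  rw [pairedProj_mulVec, mulVec_dvec]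
  obtain ⟨⟨a, c⟩, b, d⟩ := p
  by_cases h1 : (a, c) = (b, d)
  · obtain ⟨rfl, rfl⟩ := Prod.mk.inj h1
    simp [IsPaired, dvec, walk, sectorCayley, tensor4_apply, Matrix.one_apply,
      add_mul, mul_add, Finset.sum_add_distrib, mul_assoc, Finset.mul_sum]
  · by_cases h2 : (a, c) = (d, b)
    · obtain ⟨rfl, rfl⟩ := Prod.mk.inj h2
      have hac : a ≠ c := by rintro rfl; exact h1 rfl
      simp [IsPaired, dvec, sectorCayley, tensor4_apply, Matrix.one_apply, hac, hac.symm,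
        add_mul, mul_add, Finset.sum_add_distrib, mul_assoc]
    · simp [IsPaired, dvec, h1, h2]

/-- At |a,c⟩⟨a,c| the four additional terms each contribute t_aa t_cc x(a,c), two with either sign.
At |a,c⟩⟨c,a| the positive ones see only x(a,a) and x(c,c), which vanish, and the negative ones give
t_ac t_ca (x(a,c) + x(c,a)) = 0. -/
theorem sectorModified_mulVec_dvec (t : Matrix ι ι ℂ) {x : ι × ι → ℂ} (hx : x ∈ antisymm ι) :
    (pairedProj ι * sectorModified t * pairedProj ι).mulVec (dvec x) = dvec (walk t x) := by
  rw [← Matrix.mulVec_mulVec, pairedProj_mulVec_dvec, ← Matrix.mulVec_mulVec]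
  ext p
  rw [pairedProj_mulVec, mulVec_dvec]
  obtain ⟨⟨a, c⟩, b, d⟩ := p
  by_cases h1 : (a, c) = (b, d)
  · obtain ⟨rfl, rfl⟩ := Prod.mk.inj h1
    simp [IsPaired, dvec, walk, sectorModified, tensor4_apply, Matrix.one_apply,
      add_mul, sub_mul, mul_add, mul_sub, Finset.sum_add_distrib, mul_assoc, Finset.mul_sum]
    ring
  · by_cases h2 : (a, c) = (d, b)
    · obtain ⟨rfl, rfl⟩ := Prod.mk.inj h2
      have hac : a ≠ c := by rintro rfl; exact h1 rfl
      simp [IsPaired, dvec, sectorModified, tensor4_apply, Matrix.one_apply, hac, hac.symm,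
        add_mul, sub_mul, mul_add, mul_sub, Finset.sum_add_distrib, mul_assoc, antisymm_diag hx,
        hx a c]
    · simp [IsPaired, dvec, h1, h2]

/-- Exchanging the two bras. -/
def braSwap : Quad ι ≃ Quad ι := (Equiv.refl _).prodCongr (Equiv.prodComm ι ι)

/-- Exchanging the bras permutes the four terms having one SWAP on kets and one on bras, and fixes
the others. The Cayley operator lacks this symmetry. -/
theorem sectorModified_submatrix_braSwap (t : Matrix ι ι ℂ) :
    (pairedProj ι * sectorModified t * pairedProj ι).submatrix braSwap braSwap =
      pairedProj ι * sectorModified t * pairedProj ι := by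
  have hp : ∀ q : Quad ι, IsPaired (braSwap q) ↔ IsPaired q := by
    rintro ⟨⟨a, c⟩, b, d⟩
    simp [IsPaired, braSwap, or_comm]
  ext p q
  simp only [Matrix.submatrix_apply, pairedProj, Matrix.mul_diagonal, Matrix.diagonal_mul, hp]
  congr 2
  obtain ⟨⟨a, c⟩, b, d⟩ := p
  obtain ⟨⟨a', c'⟩, b', d'⟩ := q
  simp only [braSwap, Equiv.prodCongr_apply, Prod.map_apply, Equiv.coe_refl, id, Equiv.coe_prodComm,
    sectorModified, tensor4_apply, Matrix.smul_apply, Matrix.add_apply, Matrix.sub_apply,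
    Prod.swap_prod_mk, smul_eq_mul]
  ring

theorem sectorModified_mulVec_ovec (t : Matrix ι ι ℂ) {x : ι × ι → ℂ} (hx : x ∈ antisymm ι) :
    (pairedProj ι * sectorModified t * pairedProj ι).mulVec (ovec x) = ovec (walk t x) := by
  have h : ∀ y : ι × ι → ℂ, ovec y = dvec y ∘ braSwap := by
    intro y; ext q; rfl
  rw [h, h, ← sectorModified_mulVec_dvec t hx]
  nth_rw 1 [← sectorModified_submatrix_braSwap t]
  rw [Matrix.submatrix_mulVec_equiv]
  congr 2

theorem walk_const {t : Matrix ι ι ℂ} (ht : t * t = 1) :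
    walk t (fun _ => 1) = fun _ => 1 := by
  have h : ∀ a, ∑ b, t a b * t b a = 1 := fun a => by
    rw [← Matrix.mul_apply, ht, Matrix.one_apply_eq]
  ext p
  simp only [walk, LinearMap.coe_mk, AddHom.coe_mk, mul_one, h]
  norm_num

/-- Since t is a Hermitian involution, t_ab t_ba = |t_ab|² sums to 1 over b. The walk is thus an
average with weights 6/8, 1/8, 1/8. The sup norm bounds complex eigenvalues without any spectral
theorem. -/
theorem norm_walk_le {t : Matrix ι ι ℂ} (ht : t * t = 1) (hh : t.IsHermitian) (x : ι × ι → ℂ) :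
    ‖walk t x‖ ≤ ‖x‖ := by
  have hn : ∀ a b, ‖t a b * t b a‖ = (t a b * t b a).re := by
    intro a b
    rw [← hh.apply a b, Complex.star_def, ← Complex.normSq_eq_conj_mul_self, Complex.ofReal_re,
      Complex.norm_real, Real.norm_of_nonneg (Complex.normSq_nonneg _)]
  have hs : ∀ a, ∑ b, ‖t a b * t b a‖ = 1 := by
    intro a
    simp_rw [hn]
    rw [← Complex.re_sum, ← Matrix.mul_apply, ht, Matrix.one_apply_eq, Complex.one_re]
  have hsum : ∀ (a : ι) (f : ι → ι × ι), ‖∑ b, t a b * t b a * x (f b)‖ ≤ ‖x‖ := by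
    intro a f
    calc ‖∑ b, t a b * t b a * x (f b)‖ ≤ ∑ b, ‖t a b * t b a‖ * ‖x‖ := by
          refine norm_sum_le_of_le _ fun b _ => ?_
          rw [norm_mul]
          gcongr
          exact norm_le_pi_norm x _
      _ = ‖x‖ := by rw [← Finset.sum_mul, hs, one_mul]
  rw [pi_norm_le_iff_of_nonneg (norm_nonneg _)]
  intro p
  simp only [walk, LinearMap.coe_mk, AddHom.coe_mk]
  rw [norm_mul]
  have h1 := hsum p.1 fun b => (b, p.2)
  have h2 := hsum p.2 fun b => (p.1, b)
  have h3 := norm_le_pi_norm x p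
  have h4 : ‖6 * x p + ∑ b, t p.1 b * t b p.1 * x (b, p.2)
      + ∑ b, t p.2 b * t b p.2 * x (p.1, b)‖ ≤ 8 * ‖x‖ := by
    refine (norm_add₃_le).trans ?_
    rw [norm_mul]
    norm_num
    linarith
  norm_num
  linarith

end Walk

/-! ### Coordinates on the tensor power of a sector. -/

section Sector

variable {X ι : Type*} [Fintype X] [DecidableEq X] [Fintype ι] [DecidableEq ι]

/-- The matrix whose columns are the vectors of a family. -/
def columns (e : ι → EuclideanSpace ℂ X) : Matrix X ι ℂ := Matrix.of fun x a => e a x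

omit [DecidableEq X] [Fintype ι] in
theorem columns_conjTranspose_mul {e : ι → EuclideanSpace ℂ X} (he : Orthonormal ℂ e) :
    (columns e)ᴴ * columns e = 1 := by
  ext a b
  rw [orthonormal_iff_ite] at he
  rw [Matrix.one_apply, ← he a b, EuclideanSpace.inner_eq_star_dotProduct]
  simp [Matrix.mul_apply, columns, dotProduct, mul_comm]

omit [DecidableEq X] in
theorem quadMap_mulVec_injective {E : Matrix X ι ℂ} (hE : Eᴴ * E = 1) :
    Function.Injective (quadMap E).mulVec := by
  have h : (Eᴴ).map (starRingEnd ℂ) * E.map (starRingEnd ℂ) = 1 := by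
    rw [← Matrix.map_mul, hE]
    simp [Matrix.map_one]
  have : ((Eᴴ ⊗ₖ Eᴴ) ⊗ₖ ((Eᴴ).map (starRingEnd ℂ) ⊗ₖ (Eᴴ).map (starRingEnd ℂ))) * quadMap E
      = 1 := by
    unfold quadMap
    simp only [← Matrix.mul_kronecker_mul, hE, h, Matrix.one_kronecker_one]
  intro v w hvw
  have h2 := congrArg
    (((Eᴴ ⊗ₖ Eᴴ) ⊗ₖ ((Eᴴ).map (starRingEnd ℂ) ⊗ₖ (Eᴴ).map (starRingEnd ℂ))).mulVec) hvw
  simpa [Matrix.mulVec_mulVec, this] using h2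

/-- The inclusion of the fourfold tensor power of a sector. -/
def inclusion (e : ι → EuclideanSpace ℂ X) : (Quad ι → ℂ) →ₗ[ℂ] EuclideanSpace ℂ (Quad X) :=
  (WithLp.linearEquiv 2 ℂ (Quad X → ℂ)).symm.toLinearMap ∘ₗ (quadMap (columns e)).mulVecLin

omit [DecidableEq X] in
theorem inclusion_injective {e : ι → EuclideanSpace ℂ X} (he : Orthonormal ℂ e) :
    Function.Injective (inclusion e) :=
  (WithLp.linearEquiv 2 ℂ (Quad X → ℂ)).symm.injective.comp
    (quadMap_mulVec_injective (columns_conjTranspose_mul he))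

omit [DecidableEq ι] in
theorem toEuclideanLin_inclusion {e : ι → EuclideanSpace ℂ X} {A : Matrix (Quad X) (Quad X) ℂ}
    {a : Matrix (Quad ι) (Quad ι) ℂ} (h : A * quadMap (columns e) = quadMap (columns e) * a)
    (v : Quad ι → ℂ) :
    Matrix.toEuclideanLin A (inclusion e v) = inclusion e (a.mulVec v) := by
  change WithLp.toLp 2 (A.mulVec ((quadMap (columns e)).mulVec v)) =
    WithLp.toLp 2 ((quadMap (columns e)).mulVec (a.mulVec v))
  rw [Matrix.mulVec_mulVec, h, Matrix.mulVec_mulVec]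

omit [Fintype X] [DecidableEq X] in
theorem unit2_eq_inclusion (e : ι → EuclideanSpace ℂ X) (a b c d : ι) :
    unit2 e a b c d = inclusion e (Pi.single ((a, c), (b, d)) 1) := by
  change _ = WithLp.toLp 2 ((quadMap (columns e)).mulVec _)
  rw [Matrix.mulVec_single_one]
  unfold unit2
  congr 1
  ext q
  simp [quadMap, columns, mul_assoc]

omit [Fintype X] [DecidableEq X] in
theorem sector4_eq_range (e : ι → EuclideanSpace ℂ X) :
    sector4 e = LinearMap.range (inclusion e) := by
  apply le_antisymm
  · rw [sector4, Submodule.span_le]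
    rintro _ ⟨a, b, c, d, rfl⟩
    exact ⟨_, (unit2_eq_inclusion e a b c d).symm⟩
  · rintro _ ⟨v, rfl⟩
    rw [pi_eq_sum_univ' v, map_sum]
    refine Submodule.sum_mem _ fun q _ => ?_
    rw [map_smul]
    refine Submodule.smul_mem _ _ (Submodule.subset_span ⟨q.1.1, q.2.1, q.1.2, q.2.2, ?_⟩)
    rw [unit2_eq_inclusion]

/-- The antisymmetric difference `(a, b) - (b, a)`. -/
def pairDiff (a b : ι) : ι × ι → ℂ := Pi.single (a, b) 1 - Pi.single (b, a) 1

omit [Fintype ι] in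
theorem pairDiff_mem (a b : ι) : pairDiff a b ∈ antisymm ι := by
  intro c d
  simp only [pairDiff, Pi.sub_apply, Pi.single_apply, Prod.mk.injEq, and_comm (a := d = _)]
  ring

/-- The sum runs over ordered pairs, so every difference occurs twice; hence the factor 1/2. -/
theorem eq_sum_pairDiff {x : ι × ι → ℂ} (hx : x ∈ antisymm ι) :
    x = ∑ p : ι × ι, (x p / 2) • pairDiff p.1 p.2 := by
  ext ⟨a, b⟩
  simp only [pairDiff, Finset.sum_apply, Pi.smul_apply, Pi.sub_apply, Pi.single_apply, smul_eq_mul,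
    mul_sub, mul_ite, mul_one, mul_zero, Finset.sum_sub_distrib]
  have h : ∀ p : ι × ι, ((a, b) = (p.2, p.1)) = ((b, a) = p) := by
    intro p; ext; constructor <;> rintro h <;> cases p <;> cases h <;> rfl
  simp only [h, Prod.mk.eta, Finset.sum_ite_eq, Finset.mem_univ, if_true, hx a b]
  ring

omit [Fintype ι] in
theorem dvec_single (a b : ι) : dvec (Pi.single (a, b) (1 : ℂ)) = Pi.single ((a, b), (a, b)) 1 := by
  ext ⟨p, q⟩
  simp only [dvec, LinearMap.coe_mk, AddHom.coe_mk, Pi.single_apply, Prod.ext_iff]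
  grind

omit [Fintype ι] in
theorem ovec_single (a b : ι) : ovec (Pi.single (a, b) (1 : ℂ)) = Pi.single ((a, b), (b, a)) 1 := by
  ext ⟨p, q⟩
  obtain ⟨q1, q2⟩ := q
  simp only [ovec, LinearMap.coe_mk, AddHom.coe_mk, Pi.single_apply, Prod.ext_iff,
    Prod.swap_prod_mk]
  grind

omit [Fintype X] [DecidableEq X] in
theorem unit2_sub_unit2_diag (e : ι → EuclideanSpace ℂ X) (a b : ι) :
    unit2 e a a b b - unit2 e b b a a = inclusion e (dvec (pairDiff a b)) := by
  rw [unit2_eq_inclusion, unit2_eq_inclusion, pairDiff, map_sub, map_sub,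
    dvec_single, dvec_single]

omit [Fintype X] [DecidableEq X] in
theorem unit2_sub_unit2_off (e : ι → EuclideanSpace ℂ X) (a b : ι) :
    unit2 e a b b a - unit2 e b a a b = inclusion e (ovec (pairDiff a b)) := by
  rw [unit2_eq_inclusion, unit2_eq_inclusion, pairDiff, map_sub, map_sub,
    ovec_single, ovec_single]

omit [Fintype X] [DecidableEq X] in
-- Sum and difference of the generators of S₋₊ and S₊₋ recover the diagonal and the exchanged parts
-- separately.
theorem mem_sOff_iff (e : ι → EuclideanSpace ℂ X) (v : EuclideanSpace ℂ (Quad X)) :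
    v ∈ sOff e ↔ ∃ x ∈ antisymm ι, ∃ y ∈ antisymm ι, v = inclusion e (dvec x + ovec y) := by
  constructor
  · let N : Submodule ℂ (EuclideanSpace ℂ (Quad X)) :=
      (((antisymm ι).map dvec) ⊔ ((antisymm ι).map ovec)).map (inclusion e)
    have hN : ∀ w ∈ N, ∃ x ∈ antisymm ι, ∃ y ∈ antisymm ι, w = inclusion e (dvec x + ovec y) := by
      rintro _ ⟨u, hu, rfl⟩
      obtain ⟨_, ⟨x, hx, rfl⟩, _, ⟨y, hy, rfl⟩, rfl⟩ := Submodule.mem_sup.1 hu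
      exact ⟨x, hx, y, hy, rfl⟩
    have hd : ∀ a b, inclusion e (dvec (pairDiff a b)) ∈ N := fun a b =>
      Submodule.mem_map_of_mem (Submodule.mem_sup_left (Submodule.mem_map_of_mem (pairDiff_mem a b)))
    have ho : ∀ a b, inclusion e (ovec (pairDiff a b)) ∈ N := fun a b =>
      Submodule.mem_map_of_mem (Submodule.mem_sup_right (Submodule.mem_map_of_mem (pairDiff_mem a b)))
    intro hv
    refine hN v ((sup_le (Submodule.span_le.2 ?_) (Submodule.span_le.2 ?_) : sOff e ≤ N) hv)
    · rintro _ ⟨a, b, -, rfl⟩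
      rw [unit2_sub_unit2_diag, unit2_sub_unit2_off]
      exact N.smul_mem _ (N.sub_mem (hd a b) (ho a b))
    · rintro _ ⟨a, b, -, rfl⟩
      rw [unit2_sub_unit2_diag, unit2_sub_unit2_off]
      exact N.smul_mem _ (N.add_mem (hd a b) (ho a b))
  · rintro ⟨x, hx, y, hy, rfl⟩
    have hpm : ∀ a b, (1 / 2 : ℂ) • (inclusion e (dvec (pairDiff a b))
        - inclusion e (ovec (pairDiff a b))) ∈ sOff e := by
      intro a b
      by_cases hab : a = b
      · subst hab; simp [pairDiff]
      · refine Submodule.mem_sup_left (Submodule.subset_span ⟨a, b, hab, ?_⟩)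
        rw [unit2_sub_unit2_diag, unit2_sub_unit2_off]
    have hmp : ∀ a b, (1 / 2 : ℂ) • (inclusion e (dvec (pairDiff a b))
        + inclusion e (ovec (pairDiff a b))) ∈ sOff e := by
      intro a b
      by_cases hab : a = b
      · subst hab; simp [pairDiff]
      · refine Submodule.mem_sup_right (Submodule.subset_span ⟨a, b, hab, ?_⟩)
        rw [unit2_sub_unit2_diag, unit2_sub_unit2_off]
    rw [map_add]
    refine Submodule.add_mem _ ?_ ?_
    · rw [eq_sum_pairDiff hx, map_sum, map_sum]
      refine Submodule.sum_mem _ fun p _ => ?_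
      rw [map_smul, map_smul]
      refine Submodule.smul_mem _ _ ?_
      convert Submodule.add_mem _ (hpm p.1 p.2) (hmp p.1 p.2) using 1
      module
    · rw [eq_sum_pairDiff hy, map_sum, map_sum]
      refine Submodule.sum_mem _ fun p _ => ?_
      rw [map_smul, map_smul]
      refine Submodule.smul_mem _ _ ?_
      convert Submodule.sub_mem _ (hmp p.1 p.2) (hpm p.1 p.2) using 1
      module

omit [Fintype ι] in
-- The two families share only the coordinates with a = c, where antisymmetric functions vanish.
theorem dvec_add_ovec_eq_zero {x y : ι × ι → ℂ} (hx : x ∈ antisymm ι) (hy : y ∈ antisymm ι)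
    (h : dvec x + ovec y = 0) : x = 0 ∧ y = 0 := by
  constructor <;> ext ⟨a, c⟩ <;> by_cases hac : a = c
  · subst hac; exact antisymm_diag hx a
  · simpa [dvec, ovec, hac] using congrFun h ((a, c), (a, c))
  · subst hac; exact antisymm_diag hy a
  · simpa [dvec, ovec, hac] using congrFun h ((a, c), (c, a))

omit [Fintype ι] in
theorem dvec_injective : Function.Injective (dvec : (ι × ι → ℂ) →ₗ[ℂ] (Quad ι → ℂ)) := by
  intro x y h
  ext p
  simpa [dvec] using congrFun h (p, p)

/-! ### Restriction of the moment operators to a sector -/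

omit [DecidableEq X] in
theorem isHermitian_of_intertwine {P : Matrix X X ℂ} {E : Matrix X ι ℂ} {t : Matrix ι ι ℂ}
    (hE : Eᴴ * E = 1) (hP : P.IsHermitian) (h : P * E = E * t) : t.IsHermitian := by
  have : t = Eᴴ * P * E := by rw [Matrix.mul_assoc, h, ← Matrix.mul_assoc, hE, Matrix.one_mul]
  rw [this]
  exact Matrix.isHermitian_conjTranspose_mul_mul E hP

theorem mul_self_of_intertwine {P : Matrix X X ℂ} {E : Matrix X ι ℂ} {t : Matrix ι ι ℂ}
    (hE : Eᴴ * E = 1) (hP : P * P = 1) (h : P * E = E * t) : t * t = 1 := by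
  calc t * t = (Eᴴ * E) * (t * t) := by rw [hE, Matrix.one_mul]
    _ = Eᴴ * (E * t * t) := by simp only [Matrix.mul_assoc]
    _ = Eᴴ * (P * (P * E)) := by rw [← h, Matrix.mul_assoc P, ← h]
    _ = 1 := by rw [← Matrix.mul_assoc P, hP, Matrix.one_mul, hE]

omit [Fintype ι] [DecidableEq ι] in
-- This is why bras carry `tᵀ`: the SWAP is real in the computational basis, but its matrix `t` in
-- the sector basis need not be.
theorem map_transpose_of_isHermitian {t : Matrix ι ι ℂ} (ht : t.IsHermitian) :
    tᵀ.map (starRingEnd ℂ) = t := ht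

theorem modifiedSwap_mul_quadMap {P : Matrix X X ℂ} {E : Matrix X ι ℂ} {t : Matrix ι ι ℂ}
    (ht : t.IsHermitian) (hP : P.map (starRingEnd ℂ) = P) (h : P * E = E * t) :
    modifiedSwap P * quadMap E = quadMap E * sectorModified t := by
  have h1 : (1 : Matrix X X ℂ) * E = E * (1 : Matrix ι ι ℂ) := by simp
  have h1' : (1 : Matrix X X ℂ).map (starRingEnd ℂ) * E =
      E * (1 : Matrix ι ι ℂ).map (starRingEnd ℂ) := by simp [Matrix.map_one]
  have h' : P.map (starRingEnd ℂ) * E = E * tᵀ.map (starRingEnd ℂ) := by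
    rw [hP, map_transpose_of_isHermitian ht, h]
  unfold modifiedSwap sectorModified
  simp only [Matrix.smul_mul, Matrix.mul_smul, Matrix.add_mul, Matrix.mul_add, Matrix.sub_mul,
    Matrix.mul_sub, tensor4_mul_quadMap h1 h1 h1' h1', tensor4_mul_quadMap h1 h h1' h',
    tensor4_mul_quadMap h h1 h' h1', tensor4_mul_quadMap h h1 h1' h',
    tensor4_mul_quadMap h1 h h' h1', tensor4_mul_quadMap h1 h1 h' h', tensor4_mul_quadMap h h h1' h1']

theorem cayleySwap_mul_quadMap {P : Matrix X X ℂ} {E : Matrix X ι ℂ} {t : Matrix ι ι ℂ}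
    (ht : t.IsHermitian) (hP : P.map (starRingEnd ℂ) = P) (h : P * E = E * t) :
    cayleySwap P * quadMap E = quadMap E * sectorCayley t := by
  have h1 : (1 : Matrix X X ℂ) * E = E * (1 : Matrix ι ι ℂ) := by simp
  have h1' : (1 : Matrix X X ℂ).map (starRingEnd ℂ) * E =
      E * (1 : Matrix ι ι ℂ).map (starRingEnd ℂ) := by simp [Matrix.map_one]
  have h' : P.map (starRingEnd ℂ) * E = E * tᵀ.map (starRingEnd ℂ) := by
    rw [hP, map_transpose_of_isHermitian ht, h]
  unfold cayleySwap sectorCayley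
  simp only [Matrix.smul_mul, Matrix.mul_smul, Matrix.add_mul, Matrix.mul_add,
    tensor4_mul_quadMap h1 h1 h1' h1', tensor4_mul_quadMap h1 h h1' h',
    tensor4_mul_quadMap h h1 h' h1']

theorem conjugatedAverage_inclusion {n : ℕ} {G : Fin n → Matrix X X ℂ}
    {P : Equiv.Perm (Fin n) → Matrix X X ℂ} {𝒯 : Finset (Equiv.Perm (Fin n))}
    {F : Matrix X X ℂ → Matrix (Quad X) (Quad X) ℂ} {f : Matrix ι ι ℂ → Matrix (Quad ι) (Quad ι) ℂ}
    {e : ι → EuclideanSpace ℂ X} {t : Equiv.Perm (Fin n) → Matrix ι ι ℂ}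
    (hG : moment2 G * quadMap (columns e) = quadMap (columns e) * pairedProj ι)
    (hF : ∀ τ ∈ 𝒯, F (P τ) * quadMap (columns e) = quadMap (columns e) * f (t τ))
    (v : Quad ι → ℂ) :
    conjugatedAverage G P 𝒯 F (inclusion e v) =
      inclusion e ((𝒯.card : ℂ)⁻¹ • ∑ τ ∈ 𝒯, (pairedProj ι * f (t τ) * pairedProj ι).mulVec v) := by
  rw [conjugatedAverage, toEuclideanLin_inclusion
    (a := (𝒯.card : ℂ)⁻¹ • ∑ τ ∈ 𝒯, pairedProj ι * f (t τ) * pairedProj ι)]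
  · rw [Matrix.smul_mulVec, Matrix.sum_mulVec]
  · rw [Matrix.smul_mul, Matrix.mul_smul, Matrix.sum_mul, Matrix.mul_sum]
    congr 1
    refine Finset.sum_congr rfl fun τ hτ => ?_
    rw [Matrix.mul_assoc, hG, Matrix.mul_assoc (moment2 G), ← Matrix.mul_assoc (F (P τ)), hF τ hτ,
      ← Matrix.mul_assoc (moment2 G), ← Matrix.mul_assoc (moment2 G), hG]
    simp only [Matrix.mul_assoc]

/-- The average of the random walks of a family of SWAPs. -/
def averageWalk {κ : Type*} (𝒯 : Finset κ) (t : κ → Matrix ι ι ℂ) :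
    (ι × ι → ℂ) →ₗ[ℂ] (ι × ι → ℂ) :=
  (𝒯.card : ℂ)⁻¹ • ∑ τ ∈ 𝒯, walk (t τ)

omit [DecidableEq ι] in
theorem averageWalk_apply {κ : Type*} (𝒯 : Finset κ) (t : κ → Matrix ι ι ℂ) (x : ι × ι → ℂ) :
    averageWalk 𝒯 t x = (𝒯.card : ℂ)⁻¹ • ∑ τ ∈ 𝒯, walk (t τ) x := by
  simp [averageWalk]

omit [DecidableEq ι] in
theorem averageWalk_mem_antisymm {κ : Type*} (𝒯 : Finset κ) (t : κ → Matrix ι ι ℂ)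
    {x : ι × ι → ℂ} (hx : x ∈ antisymm ι) : averageWalk 𝒯 t x ∈ antisymm ι := by
  rw [averageWalk_apply]
  exact Submodule.smul_mem _ _ (Submodule.sum_mem _ fun τ _ => walk_mem_antisymm _ hx)

theorem averageWalk_const {κ : Type*} {𝒯 : Finset κ} (h𝒯 : 𝒯.Nonempty) {t : κ → Matrix ι ι ℂ}
    (ht : ∀ τ ∈ 𝒯, t τ * t τ = 1) : averageWalk 𝒯 t (fun _ => 1) = fun _ => 1 := by
  have h0 : (𝒯.card : ℂ) ≠ 0 := by exact_mod_cast h𝒯.card_pos.ne'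
  rw [averageWalk_apply, Finset.sum_congr rfl fun τ hτ => walk_const (ht τ hτ)]
  ext p
  simp [h0]

theorem norm_averageWalk_le {κ : Type*} {𝒯 : Finset κ} (h𝒯 : 𝒯.Nonempty) {t : κ → Matrix ι ι ℂ}
    (ht : ∀ τ ∈ 𝒯, t τ * t τ = 1) (hh : ∀ τ ∈ 𝒯, (t τ).IsHermitian) (x : ι × ι → ℂ) :
    ‖averageWalk 𝒯 t x‖ ≤ ‖x‖ := by
  have h0 : (0 : ℝ) < 𝒯.card := by exact_mod_cast h𝒯.card_pos
  rw [averageWalk_apply, norm_smul, norm_inv, Complex.norm_natCast, inv_mul_le_iff₀ h0]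
  refine (norm_sum_le_of_le _ fun τ hτ => norm_walk_le (ht τ hτ) (hh τ hτ) x).trans ?_
  simp

/-- The hypotheses collect what the two symmetries have in common: integer joint eigenvalues
separating the basis, and real Hermitian involutions preserving the sector. -/
theorem eig_modifiedCQA_le_eig_cayley [Nontrivial ι] {n : ℕ} {G : Fin n → Matrix X X ℂ}
    {P : Equiv.Perm (Fin n) → Matrix X X ℂ} {𝒯 : Finset (Equiv.Perm (Fin n))} (h𝒯 : 𝒯.Nonempty)
    {e : ι → EuclideanSpace ℂ X} (he : Orthonormal ℂ e) {g : Fin n → ι → ℤ}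
    (hG : ∀ r a, Matrix.toEuclideanLin (G r) (e a) = (g r a : ℂ) • e a)
    (hg : Function.Injective fun a r => g r a)
    (hPh : ∀ τ ∈ 𝒯, (P τ).IsHermitian) (hPr : ∀ τ ∈ 𝒯, (P τ).map (starRingEnd ℂ) = P τ)
    (hPP : ∀ τ ∈ 𝒯, P τ * P τ = 1)
    (hPe : ∀ τ ∈ 𝒯, ∀ a, Matrix.toEuclideanLin (P τ) (e a) ∈ Submodule.span ℂ (Set.range e)) :
    ∃ (hM : ∀ v ∈ sOff e, modifiedCQA G P 𝒯 v ∈ sOff e)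
      (hC : ∀ v ∈ sector4 e, cayley G P 𝒯 v ∈ sector4 e),
      eig 1 ((modifiedCQA G P 𝒯).restrict hM) ≤ eig 2 ((cayley G P 𝒯).restrict hC) := by
  have hE := columns_conjTranspose_mul he
  have hG' : ∀ r, G r * columns e = columns e * Matrix.diagonal fun a => (g r a : ℂ) := by
    intro r
    ext x a
    have := congrArg (fun v : EuclideanSpace ℂ X => v x) (hG r a)
    rw [Matrix.mul_diagonal]
    simpa [Matrix.mul_apply, columns, Matrix.toLpLin_apply, Matrix.mulVec,
      dotProduct, mul_comm] using this
  have hmom := moment2_mul_quadMap hG' hg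
  have hex : ∀ τ : Equiv.Perm (Fin n), ∃ t : Matrix ι ι ℂ, τ ∈ 𝒯 → P τ * columns e = columns e * t := by
    intro τ
    by_cases hτ : τ ∈ 𝒯
    · choose c hc using fun a => (Submodule.mem_span_range_iff_exists_fun ℂ).1 (hPe τ hτ a)
      refine ⟨Matrix.of fun b a => c a b, fun _ => ?_⟩
      ext x a
      have := congrArg (fun v : EuclideanSpace ℂ X => v x) (hc a)
      simp only [Matrix.toLpLin_apply] at this
      simpa [Matrix.mul_apply, columns, Matrix.mulVec, dotProduct, mul_comm] using this.symm
    · exact ⟨0, fun h => absurd h hτ⟩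
  choose t ht using hex
  have hth : ∀ τ ∈ 𝒯, (t τ).IsHermitian := fun τ hτ =>
    isHermitian_of_intertwine hE (hPh τ hτ) (ht τ hτ)
  have htt : ∀ τ ∈ 𝒯, t τ * t τ = 1 := fun τ hτ =>
    mul_self_of_intertwine hE (hPP τ hτ) (ht τ hτ)
  have hMi : ∀ v, modifiedCQA G P 𝒯 (inclusion e v) = _ :=
    conjugatedAverage_inclusion (f := sectorModified) (t := t) hmom fun τ hτ =>
      modifiedSwap_mul_quadMap (hth τ hτ) (hPr τ hτ) (ht τ hτ)
  have hCi : ∀ v, cayley G P 𝒯 (inclusion e v) = _ :=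
    conjugatedAverage_inclusion (f := sectorCayley) (t := t) hmom fun τ hτ =>
      cayleySwap_mul_quadMap (hth τ hτ) (hPr τ hτ) (ht τ hτ)
  have hMK : ∀ x ∈ antisymm ι, ∀ y ∈ antisymm ι,
      modifiedCQA G P 𝒯 (inclusion e (dvec x + ovec y)) =
        inclusion e (dvec (averageWalk 𝒯 t x) + ovec (averageWalk 𝒯 t y)) := by
    intro x hx y hy
    rw [hMi]
    simp only [Matrix.mulVec_add, sectorModified_mulVec_dvec _ hx, sectorModified_mulVec_ovec _ hy,
      averageWalk_apply, map_smul, map_sum, Finset.sum_add_distrib, smul_add]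
  have hCK : ∀ x, cayley G P 𝒯 (inclusion e (dvec x)) = inclusion e (dvec (averageWalk 𝒯 t x)) := by
    intro x
    rw [hCi]
    simp only [sectorCayley_mulVec_dvec, averageWalk_apply, map_smul, map_sum]
  have hM : ∀ v ∈ sOff e, modifiedCQA G P 𝒯 v ∈ sOff e := by
    intro v hv
    obtain ⟨x, hx, y, hy, rfl⟩ := (mem_sOff_iff e v).1 hv
    rw [hMK x hx y hy]
    exact (mem_sOff_iff e _).2 ⟨_, averageWalk_mem_antisymm 𝒯 t hx, _,
      averageWalk_mem_antisymm 𝒯 t hy, rfl⟩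
  have hC : ∀ v ∈ sector4 e, cayley G P 𝒯 v ∈ sector4 e := by
    rw [sector4_eq_range]
    rintro _ ⟨v, rfl⟩
    rw [hCi]
    exact ⟨_, rfl⟩
  have hdmem : ∀ x, inclusion e (dvec x) ∈ sector4 e := by
    intro x
    rw [sector4_eq_range]
    exact ⟨_, rfl⟩
  have hinj := inclusion_injective he
  have : Nontrivial (sOff e) := by
    obtain ⟨a, b, hab⟩ := exists_pair_ne ι
    have hmem : inclusion e (dvec (pairDiff a b) + ovec 0) ∈ sOff e :=
      (mem_sOff_iff e _).2 ⟨_, pairDiff_mem a b, 0, Submodule.zero_mem _, rfl⟩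
    refine ⟨⟨⟨_, hmem⟩, 0, fun h => ?_⟩⟩
    have h1 := (dvec_add_ovec_eq_zero (pairDiff_mem a b) (Submodule.zero_mem _)
      (hinj ((congrArg Subtype.val h).trans (map_zero _).symm))).1
    simpa [pairDiff, hab] using congrFun h1 (a, b)
  refine ⟨hM, hC, ?_⟩
  refine eig_one_le_eig_two _ _ ⟨inclusion e (dvec fun _ => 1), hdmem _⟩ ?_ ?_
  · ext1
    rw [LinearMap.coe_restrict_apply, hCK, averageWalk_const h𝒯 htt]
  · rintro z ⟨v, hv⟩ hv0 hvz
    obtain ⟨x, hx, y, hy, rfl⟩ := (mem_sOff_iff e v).1 hv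
    have hvz' := congrArg Subtype.val hvz
    rw [LinearMap.coe_restrict_apply, hMK x hx y hy] at hvz'
    replace hvz' := hinj (hvz'.trans (map_smul (inclusion e) z _).symm)
    have hz : dvec (averageWalk 𝒯 t x - z • x) + ovec (averageWalk 𝒯 t y - z • y) = 0 := by
      rw [map_sub, map_sub, map_smul, map_smul, sub_add_sub_comm, hvz', smul_add, sub_self]
    obtain ⟨hzx, hzy⟩ := dvec_add_ovec_eq_zero
      (Submodule.sub_mem _ (averageWalk_mem_antisymm 𝒯 t hx) (Submodule.smul_mem _ z hx))
      (Submodule.sub_mem _ (averageWalk_mem_antisymm 𝒯 t hy) (Submodule.smul_mem _ z hy)) hz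
    -- An eigenvector of M₂ has two components, each satisfying the same walk equation; a nonzero
    -- one is transferred to Cay₂.
    obtain ⟨w, hw, hw0, hwz⟩ : ∃ w ∈ antisymm ι, w ≠ 0 ∧ averageWalk 𝒯 t w = z • w := by
      by_cases hx0 : x = 0
      · refine ⟨y, hy, ?_, sub_eq_zero.1 hzy⟩
        rintro rfl
        apply hv0
        ext1
        simp [hx0]
      · exact ⟨x, hx, hx0, sub_eq_zero.1 hzx⟩
    constructor
    · have h1 := norm_averageWalk_le h𝒯 htt hth w
      rw [hwz, norm_smul] at h1
      have h2 : 0 < ‖w‖ := norm_pos_iff.2 hw0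
      have h3 : ‖z‖ ≤ 1 := by
        by_contra h
        push Not at h
        nlinarith
      exact (Complex.re_le_norm z).trans h3
    · refine ⟨⟨inclusion e (dvec w), hdmem _⟩, ?_, ?_⟩
      · ext1
        rw [LinearMap.coe_restrict_apply, hCK, hwz, map_smul, map_smul]
        rfl
      · rw [LinearIndependent.pair_iff]
        intro s r hsr
        have h1 : inclusion e (dvec (s • (fun _ => 1) + r • w)) = inclusion e (dvec 0) := by
          have := congrArg Subtype.val hsr
          simpa using this
        have h2 := dvec_injective (hinj h1)
        obtain ⟨a⟩ : Nonempty ι := inferInstance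
        -- On a diagonal pair `w` vanishes while the constant function is 1.
        have hs : s = 0 := by simpa [antisymm_diag hw a] using congrFun h2 (a, a)
        subst hs
        refine ⟨rfl, ?_⟩
        rw [zero_smul, zero_add] at h2
        exact (smul_eq_zero.1 h2).resolve_right hw0

end Sector

/-! ### Permutation operators and SWAPs. -/

theorem permOp_mul (n d : ℕ) (σ τ : Equiv.Perm (Fin n)) :
    permOp n d σ * permOp n d τ = permOp n d (σ * τ) := by
  ext y x
  simp only [permOp, Matrix.mul_apply, Matrix.of_apply, mul_ite, mul_one, mul_zero,
    Finset.sum_ite_eq', Finset.mem_univ, if_true, mul_inv_rev, Equiv.Perm.coe_mul]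
  rfl

theorem permOp_one (n d : ℕ) : permOp n d 1 = 1 := by
  ext y x
  simp [permOp, Matrix.one_apply]

theorem permOp_map_conj (n d : ℕ) (σ : Equiv.Perm (Fin n)) :
    (permOp n d σ).map (starRingEnd ℂ) = permOp n d σ := by
  ext y x
  simp [permOp, apply_ite (starRingEnd ℂ)]

theorem permOp_transpose (n d : ℕ) (σ : Equiv.Perm (Fin n)) :
    (permOp n d σ)ᵀ = permOp n d σ⁻¹ := by
  ext y x
  simp only [permOp, Matrix.transpose_apply, Matrix.of_apply, inv_inv]
  congr 1
  rw [eq_iff_iff]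
  constructor <;> rintro rfl <;> ext i <;> simp

theorem isSwap_mul_self {n : ℕ} {τ : Equiv.Perm (Fin n)} (h : τ.IsSwap) : τ * τ = 1 := by
  obtain ⟨i, j, -, rfl⟩ := h
  exact Equiv.swap_mul_self i j

theorem permOp_mul_self_of_isSwap {n : ℕ} (d : ℕ) {τ : Equiv.Perm (Fin n)} (h : τ.IsSwap) :
    permOp n d τ * permOp n d τ = 1 := by
  rw [permOp_mul, isSwap_mul_self h, permOp_one]

theorem permOp_isHermitian_of_isSwap {n : ℕ} (d : ℕ) {τ : Equiv.Perm (Fin n)} (h : τ.IsSwap) :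
    (permOp n d τ).IsHermitian := by
  have : τ⁻¹ = τ := inv_eq_of_mul_eq_one_left (isSwap_mul_self h)
  change ((permOp n d τ)ᵀ).map (starRingEnd ℂ) = _
  rw [permOp_transpose, permOp_map_conj, this]

/-- Nonemptiness makes the normalisation by the cardinality a genuine average, so that constants are
fixed. -/
theorem nonempty_of_closure_eq_top {n : ℕ} (hn : 2 ≤ n) {𝒯 : Finset (Equiv.Perm (Fin n))}
    (h : Subgroup.closure (𝒯 : Set (Equiv.Perm (Fin n))) = ⊤) : 𝒯.Nonempty := by
  rw [Finset.nonempty_iff_ne_empty]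
  rintro rfl
  rw [Finset.coe_empty, Subgroup.closure_empty] at h
  have hs : Equiv.swap (⟨0, by omega⟩ : Fin n) ⟨1, by omega⟩ ∈ (⊥ : Subgroup (Equiv.Perm (Fin n))) :=
    h ▸ Subgroup.mem_top _
  rw [Subgroup.mem_bot, Equiv.swap_eq_one_iff] at hs
  simp at hs

/-! ### The charge sectors -/

theorem toEuclideanLin_permOp_single (n d : ℕ) (σ : Equiv.Perm (Fin n)) (x : Fin n → Fin d) :
    Matrix.toEuclideanLin (permOp n d σ) (EuclideanSpace.single x 1) =
      EuclideanSpace.single (x ∘ ⇑σ⁻¹) 1 := by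
  ext y
  simp [Matrix.toLpLin_apply, permOp]

/-- The permutation action on the bit strings of fixed charge. -/
def ChargeString.perm {n r : ℕ} (σ : Equiv.Perm (Fin n)) (x : ChargeString n r) :
    ChargeString n r :=
  ⟨x.1 ∘ σ, (Finset.card_equiv σ (by simp)).trans x.2⟩

theorem nontrivial_chargeString {n r : ℕ} (h0 : 0 < r) (hr : r < n) :
    Nontrivial (ChargeString n r) := by
  let x : ChargeString n r := ⟨fun i => if (i : ℕ) < r then 0 else 1, by
    simp [Fin.card_filter_val_lt, hr.le]⟩
  -- Position 0 carries a zero and position `r` a one, so exchanging them changes the string.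
  refine ⟨⟨x, x.perm (Equiv.swap ⟨0, by omega⟩ ⟨r, hr⟩), fun h => ?_⟩⟩
  have := congrFun (congrArg Subtype.val h) ⟨0, by omega⟩
  simp [x, ChargeString.perm, h0] at this

theorem chargeBasis_orthonormal (n r : ℕ) : Orthonormal ℂ (chargeBasis n r) :=
  (EuclideanSpace.orthonormal_single).comp _ Subtype.val_injective

/-- The eigenvalue of the Pauli matrix `Z` on a bit. -/
def bitSign (b : Fin 2) : ℤ := if b = 0 then 1 else -1

theorem bitSign_injective : Function.Injective bitSign := by decide

theorem toEuclideanLin_pauliZ_chargeBasis {n r : ℕ} (i : Fin n) (x : ChargeString n r) :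
    Matrix.toEuclideanLin (pauliZ n i) (chargeBasis n r x) =
      (bitSign (x.1 i) : ℂ) • chargeBasis n r x := by
  ext y
  simp only [Matrix.toLpLin_apply, pauliZ, chargeBasis, bitSign, Matrix.mulVec_diagonal,
    PiLp.ofLp_single, PiLp.smul_apply, smul_eq_mul, Pi.single_apply]
  by_cases h : y = x.1 <;> simp [h]

/-! ### Standard tableaux -/

namespace StandardTableau

variable {μ : YoungDiagram} {n : ℕ} (T : StandardTableau μ n)

theorem exists_entry {p q : ℕ} {l : Fin n} (hp : p ≤ (T.cell l).1.1) (hq : q ≤ (T.cell l).1.2) :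
    ∃ m, (T.cell m).1 = (p, q) := by
  have hm : (p, q) ∈ μ.cells :=
    μ.isLowerSet (show (p, q) ≤ (T.cell l).1 from ⟨hp, hq⟩) (T.cell l).2
  exact ⟨T.cell.symm ⟨(p, q), hm⟩, by simp⟩

theorem eq_of_cell {k l : Fin n} (h : (T.cell k).1 = (T.cell l).1) : k = l :=
  T.cell.injective (Subtype.ext h)

theorem le_of_row {k l : Fin n} (h1 : (T.cell k).1.1 = (T.cell l).1.1)
    (h2 : (T.cell k).1.2 ≤ (T.cell l).1.2) : k ≤ l := by
  rcases h2.lt_or_eq with h2 | h2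
  · exact (T.row_lt k l h1 h2).le
  · exact (T.eq_of_cell (Prod.ext h1 h2)).le

theorem le_of_col {k l : Fin n} (h1 : (T.cell k).1.2 = (T.cell l).1.2)
    (h2 : (T.cell k).1.1 ≤ (T.cell l).1.1) : k ≤ l := by
  rcases h2.lt_or_eq with h2 | h2
  · exact (T.col_lt k l h1 h2).le
  · exact (T.eq_of_cell (Prod.ext h2 h1)).le

/-- Compare through the entry in the row of `k` and the column of `l`. -/
theorem le_of_cell_le {k l : Fin n} (h1 : (T.cell k).1.1 ≤ (T.cell l).1.1)
    (h2 : (T.cell k).1.2 ≤ (T.cell l).1.2) : k ≤ l := by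
  obtain ⟨m, hm⟩ := T.exists_entry h1 le_rfl (l := l)
  refine (T.le_of_row (l := m) ?_ ?_).trans (T.le_of_col ?_ ?_) <;> simp [hm, h1, h2]

theorem content_zero {i : Fin n} (hi : (i : ℕ) = 0) : T.content i = 0 := by
  obtain ⟨m, hm⟩ := T.exists_entry (Nat.zero_le _) (Nat.zero_le _) (l := i)
  have hmi : m ≤ i := T.le_of_cell_le (by simp [hm]) (by simp [hm])
  have : m = i := Fin.ext (by have := Fin.le_def.1 hmi; omega)
  subst this
  simp [content, hm]

theorem ext_cell {T T' : StandardTableau μ n} (h : T.cell = T'.cell) : T = T' := by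
  cases T; cases T'; cases h; rfl

/-- At the first entry where two tableaux differ, equal contents put both cells on one diagonal. The
upper-left one is occupied by a smaller entry in the other tableau, where the two already agree. -/
theorem content_injective :
    Function.Injective fun (T : StandardTableau μ n) (i : Fin n) => T.content i := by
  have key : ∀ (T T' : StandardTableau μ n) (i : Fin n), T.content i = T'.content i →
      (∀ j < i, T.cell j = T'.cell j) → ¬ (T.cell i).1.1 < (T'.cell i).1.1 := by
    intro T T' i hc hj hlt
    have hlt2 : (T.cell i).1.2 < (T'.cell i).1.2 := by
      simp only [content] at hc; omega
    obtain ⟨m, hm⟩ := T'.exists_entry hlt.le hlt2.le (l := i)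
    have hmi : m < i := by
      refine lt_of_le_of_ne (T'.le_of_cell_le ?_ ?_) ?_
      · rw [hm]; exact hlt.le
      · rw [hm]; exact hlt2.le
      · rintro rfl
        rw [hm] at hlt
        exact lt_irrefl _ hlt
    have := hj m hmi
    exact hmi.ne (T.eq_of_cell (by rw [this, hm]))
  intro T T' h
  have hc : ∀ i, T.content i = T'.content i := congrFun h
  apply ext_cell
  ext1 i
  induction i using WellFoundedLT.induction with
  | ind i ih =>
    have h1 := key T T' i (hc i) ih
    have h2 := key T' T i (hc i).symm fun j hj => (ih j hj).symm
    have h3 := hc i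
    simp only [content] at h3
    exact Subtype.ext (Prod.ext (by omega) (by omega))

theorem two_le_of_nontrivial [Nontrivial (StandardTableau μ n)] : 2 ≤ n := by
  obtain ⟨T, T', h⟩ := exists_pair_ne (StandardTableau μ n)
  by_contra hn
  refine h (content_injective (funext fun i => ?_))
  simp only
  rw [T.content_zero (by omega), T'.content_zero (by omega)]

/-- If `j` lay strictly below and to the right of `i`, the corner cell in the row of `i` and the
column of `j` would hold an entry strictly between them. -/
theorem content_ne {i j : Fin n} (hij : (j : ℕ) = i + 1) : T.content j - T.content i ≠ 0 := by
  intro h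
  simp only [content] at h
  rcases lt_trichotomy (T.cell j).1.1 (T.cell i).1.1 with hlt | heq | hlt
  · have := Fin.le_def.1 (T.le_of_cell_le (k := j) (l := i) hlt.le (by omega))
    omega
  · have := congrArg Fin.val (T.eq_of_cell (k := j) (l := i) (Prod.ext heq (by omega)))
    omega
  · obtain ⟨m, hm⟩ := T.exists_entry hlt.le (le_refl _) (l := j)
    have h1 := Fin.lt_def.1 (T.row_lt i m (by rw [hm]) (by rw [hm]; omega))
    have h2 := Fin.lt_def.1 (T.col_lt m j (by rw [hm]) (by rw [hm]; exact hlt))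
    omega

/-- As `i` and `j` are consecutive, exchanging them reverses no comparison except their own. -/
theorem lt_of_swap_lt {i j a b : Fin n} (hij : (j : ℕ) = i + 1)
    (hab : Equiv.swap i j a < Equiv.swap i j b)
    (hne : ¬ (Equiv.swap i j a = i ∧ Equiv.swap i j b = j)) : a < b := by
  have hne' : ¬ (a = j ∧ b = i) := by
    rintro ⟨rfl, rfl⟩
    simp at hne
  simp only [Equiv.swap_apply_def, Fin.lt_def, Fin.ext_iff] at hab hne' ⊢
  split_ifs at hab <;> omega

/-- Consecutive entries in a common row or column occupy neighbouring cells; otherwise no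
standardness condition compares them. -/
theorem adjacent_or_exists_swap {i j : Fin n} (hij : (j : ℕ) = i + 1) :
    |T.content j - T.content i| = 1 ∨
      ∃ T' : StandardTableau μ n, T'.cell = (Equiv.swap i j).trans T.cell := by
  by_cases hrow : (T.cell i).1.1 = (T.cell j).1.1
  · left
    have hlt : (T.cell i).1.2 < (T.cell j).1.2 := by
      by_contra hcon
      have := Fin.le_def.1 (T.le_of_row hrow.symm (not_lt.1 hcon))
      omega
    obtain ⟨m, hm⟩ := T.exists_entry hrow.le (Nat.succ_le_of_lt hlt)
    have h1 := Fin.lt_def.1 (T.row_lt i m (by rw [hm]) (by rw [hm]; simp))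
    have h2 : ¬ (T.cell i).1.2 + 1 < (T.cell j).1.2 := fun hcon => by
      have := Fin.lt_def.1 (T.row_lt m j (by rw [hm, hrow]) (by rw [hm]; exact hcon))
      omega
    have : T.content j - T.content i = 1 := by simp only [content]; omega
    rw [this, abs_one]
  by_cases hcol : (T.cell i).1.2 = (T.cell j).1.2
  · left
    have hlt : (T.cell i).1.1 < (T.cell j).1.1 := by
      by_contra hcon
      have := Fin.le_def.1 (T.le_of_col hcol.symm (not_lt.1 hcon))
      omega
    obtain ⟨m, hm⟩ := T.exists_entry (Nat.succ_le_of_lt hlt) hcol.le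
    have h1 := Fin.lt_def.1 (T.col_lt i m (by rw [hm]) (by rw [hm]; simp))
    have h2 : ¬ (T.cell i).1.1 + 1 < (T.cell j).1.1 := fun hcon => by
      have := Fin.lt_def.1 (T.col_lt m j (by rw [hm, hcol]) (by rw [hm]; exact hcon))
      omega
    have : T.content j - T.content i = -1 := by simp only [content]; omega
    rw [this, abs_neg, abs_one]
  · right
    refine ⟨⟨(Equiv.swap i j).trans T.cell, fun a b h1 h2 => ?_, fun a b h1 h2 => ?_⟩, rfl⟩
    · refine lt_of_swap_lt hij (T.row_lt _ _ h1 h2) ?_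
      rintro ⟨ha, hb⟩
      simp only [Equiv.trans_apply, ha, hb] at h1
      exact hrow h1
    · refine lt_of_swap_lt hij (T.col_lt _ _ h1 h2) ?_
      rintro ⟨ha, hb⟩
      simp only [Equiv.trans_apply, ha, hb] at h1
      exact hcol h1

end StandardTableau

/-! ### Young bases -/

section YoungBasis

variable {μ : YoungDiagram} {n d : ℕ} {e : StandardTableau μ n → EuclideanSpace ℂ (Fin n → Fin d)}

theorem toEuclideanLin_mul_apply {X : Type*} [Fintype X] [DecidableEq X] (A B : Matrix X X ℂ)
    (v : EuclideanSpace ℂ X) :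
    Matrix.toEuclideanLin (A * B) v = Matrix.toEuclideanLin A (Matrix.toEuclideanLin B v) := by
  simp [Matrix.toLpLin_apply, Matrix.mulVec_mulVec]

theorem IsYoungBasis.swap_mem_span (he : IsYoungBasis e) {i j : Fin n} (hij : (j : ℕ) = i + 1)
    (T : StandardTableau μ n) :
    Matrix.toEuclideanLin (permOp n d (Equiv.swap i j)) (e T) ∈
      Submodule.span ℂ (Set.range e) := by
  have hmem : ∀ T, e T ∈ Submodule.span ℂ (Set.range e) := fun T => Submodule.subset_span ⟨T, rfl⟩
  rcases T.adjacent_or_exists_swap hij with h | ⟨T', hT'⟩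
  · rw [(he.2 i j hij T).1 h]
    exact Submodule.smul_mem _ _ (hmem T)
  · rw [(he.2 i j hij T).2 T' hT']
    exact Submodule.add_mem _ (Submodule.smul_mem _ _ (hmem T)) (Submodule.smul_mem _ _ (hmem T'))

theorem IsYoungBasis.perm_mem_span (he : IsYoungBasis e) (σ : Equiv.Perm (Fin n))
    {v : EuclideanSpace ℂ (Fin n → Fin d)} (hv : v ∈ Submodule.span ℂ (Set.range e)) :
    Matrix.toEuclideanLin (permOp n d σ) v ∈ Submodule.span ℂ (Set.range e) := by
  cases n with
  | zero =>
    rw [Subsingleton.elim σ 1, permOp_one]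
    simpa using hv
  | succ n =>
    have hσ : σ ∈ Submonoid.closure
        (Set.range fun i : Fin n => Equiv.swap i.castSucc i.succ) := by
      rw [Equiv.Perm.mclosure_swap_castSucc_succ]; trivial
    induction hσ using Submonoid.closure_induction generalizing v with
    | mem x hx =>
      obtain ⟨i, rfl⟩ := hx
      have : Submodule.span ℂ (Set.range e) ≤ (Submodule.span ℂ (Set.range e)).comap
          (Matrix.toEuclideanLin (permOp (n + 1) d (Equiv.swap i.castSucc i.succ))) := by
        rw [Submodule.span_le]
        rintro _ ⟨T, rfl⟩
        exact he.swap_mem_span (by simp) T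
      exact this hv
    | one =>
      rw [permOp_one]
      simpa using hv
    | mul x y _ _ hx hy =>
      rw [← permOp_mul, toEuclideanLin_mul_apply]
      exact hx (hy hv)

/-- Conjugation by s = (i, j) sends (k, i) to (k, j) for k < i; the remaining summand of X_j is s
itself. -/
theorem yjm_succ (n d : ℕ) {i j : Fin n} (hij : (j : ℕ) = i + 1) :
    yjm n d j = permOp n d (Equiv.swap i j) * yjm n d i * permOp n d (Equiv.swap i j)
      + permOp n d (Equiv.swap i j) := by
  have hf : Finset.univ.filter (fun k => k < j) = insert i (Finset.univ.filter fun k => k < i) := by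
    ext k
    simp only [Finset.mem_filter, Finset.mem_univ, true_and, Finset.mem_insert, Fin.lt_def,
      Fin.ext_iff]
    omega
  unfold yjm
  rw [hf, Finset.sum_insert (by simp), add_comm, Matrix.mul_sum, Matrix.sum_mul]
  congr 1
  refine Finset.sum_congr rfl fun k hk => ?_
  simp only [Finset.mem_filter, Finset.mem_univ, true_and] at hk
  have hki : k ≠ i := hk.ne
  have hkj : k ≠ j := by rintro rfl; have := Fin.lt_def.1 hk; omega
  have hconj := Equiv.swap_apply_apply (Equiv.swap i j) k i
  rw [Equiv.swap_apply_of_ne_of_ne hki hkj, Equiv.swap_apply_left, Equiv.swap_inv] at hconj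
  rw [permOp_mul, permOp_mul, hconj]

/-- Induction through X_j = sX_is + s. On the span of `e T` and `e T'`, s has rows (ρ, q) and (q,
−ρ), with ρ the inverse axial distance and ρ² + q² = 1, while X_i is diagonal with the two contents.
-/
theorem IsYoungBasis.yjm_apply (he : IsYoungBasis e) (i : Fin n) (T : StandardTableau μ n) :
    Matrix.toEuclideanLin (yjm n d i) (e T) = (T.content i : ℂ) • e T := by
  obtain ⟨k, hk⟩ := i
  induction k generalizing T with
  | zero =>
    rw [T.content_zero rfl]
    have : yjm n d ⟨0, hk⟩ = 0 := by
      unfold yjm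
      rw [Finset.filter_false_of_mem (by intro x _; simp [Fin.lt_def]), Finset.sum_empty]
    rw [this]
    simp
  | succ k ih =>
    have hk' : k < n := by omega
    set i : Fin n := ⟨k, hk'⟩
    set j : Fin n := ⟨k + 1, hk⟩
    have hij : (j : ℕ) = i + 1 := rfl
    rw [yjm_succ n d hij, map_add, LinearMap.add_apply, toEuclideanLin_mul_apply,
      toEuclideanLin_mul_apply]
    have hne : ((T.content j - T.content i : ℤ) : ℂ) ≠ 0 := by exact_mod_cast T.content_ne hij
    have hρ : (1 / ((T.content j - T.content i : ℤ) : ℂ)) * (T.content j - T.content i) = 1 := by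
      push_cast at hne ⊢
      field_simp
    rcases T.adjacent_or_exists_swap hij with h | ⟨T', hT'⟩
    · have hs := (he.2 i j hij T).1 h
      have hρ2 : (T.content j - T.content i : ℂ) * (T.content j - T.content i) = 1 := by
        have : (T.content j - T.content i) * (T.content j - T.content i) = 1 := by
          rw [← abs_mul_abs_self, h, one_mul]
        exact_mod_cast this
      set ρ : ℂ := 1 / ((T.content j - T.content i : ℤ) : ℂ)
      rw [hs, map_smul, ih, map_smul, map_smul, hs, smul_smul, smul_smul, ← add_smul]
      congr 1
      -- An axial distance ±1 is its own inverse.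
      have hρ3 : ρ = T.content j - T.content i := by
        linear_combination (T.content j - T.content i : ℂ) * hρ - ρ * hρ2
      rw [hρ3]
      linear_combination (T.content i : ℂ) * hρ2
    · have hs := (he.2 i j hij T).2 T' hT'
      have hci : T'.content i = T.content j := by
        simp [StandardTableau.content, hT']
      have hcj : T'.content j = T.content i := by
        simp [StandardTableau.content, hT']
      -- Exchanging the entries exchanges the contents: ρ changes sign and q is unchanged.
      have hs' := (he.2 i j hij T').2 T (by
        rw [hT']; ext1 k; simp)
      rw [hci, hcj] at hs'
      have hρ' : 1 / ((T.content i - T.content j : ℤ) : ℂ) =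
          -(1 / ((T.content j - T.content i : ℤ) : ℂ)) := by
        rw [← neg_sub, Int.cast_neg, div_neg]
      have hsq' : ((T.content i - T.content j : ℤ) : ℝ) ^ 2 =
          ((T.content j - T.content i : ℤ) : ℝ) ^ 2 := by
        push_cast; ring
      rw [hρ', hsq'] at hs'
      have hge : (1 : ℝ) ≤ ((T.content j - T.content i : ℤ) : ℝ) ^ 2 := by
        have : 0 < (T.content j - T.content i) ^ 2 := by
          have := T.content_ne hij
          positivity
        exact_mod_cast this
      have hq : (((√(1 - 1 / ((T.content j - T.content i : ℤ) : ℝ) ^ 2) : ℝ) : ℂ)) *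
          ((√(1 - 1 / ((T.content j - T.content i : ℤ) : ℝ) ^ 2) : ℝ) : ℂ) =
          1 - (1 / ((T.content j - T.content i : ℤ) : ℂ)) ^ 2 := by
        rw [← Complex.ofReal_mul, Real.mul_self_sqrt]
        · push_cast; rw [one_div_pow]
        · rw [sub_nonneg]
          exact div_le_one_of_le₀ hge (by positivity)
      set ρ : ℂ := 1 / ((T.content j - T.content i : ℤ) : ℂ)
      set q : ℂ := ((√(1 - 1 / ((T.content j - T.content i : ℤ) : ℝ) ^ 2) : ℝ) : ℂ)
      rw [hs]
      have hi : ∀ T, Matrix.toEuclideanLin (yjm n d i) (e T) = (T.content i : ℂ) • e T :=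
        fun T => ih T hk'
      simp only [map_add, map_smul, hi, hci]
      rw [hs, hs']
      have e1 : ρ * T.content i * ρ + q * T.content j * q + ρ = T.content j := by
        linear_combination (T.content j : ℂ) * hq - ρ * hρ
      have e2 : ρ * T.content i * q - q * T.content j * ρ + q = 0 := by
        linear_combination -q * hρ
      calc _ = (ρ * T.content i * ρ + q * T.content j * q + ρ) • e T
            + (ρ * T.content i * q - q * T.content j * ρ + q) • e T' := by module
        _ = _ := by rw [e1, e2, zero_smul, add_zero]

end YoungBasis

end CQA

end

/-! ### The two symmetry cases. -/

theorem mainTheorem4 :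
    -- `U(1)` symmetry: `n` qubits, a charge sector of dimension at least two
    (∀ (n r : ℕ), 0 < r → r < n →
      ∀ 𝒯 : Finset (Equiv.Perm (Fin n)), (∀ τ ∈ 𝒯, τ.IsSwap) →
        Subgroup.closure (𝒯 : Set (Equiv.Perm (Fin n))) = ⊤ →
      ∃ (hM : ∀ v ∈ CQA.sOff (CQA.chargeBasis n r),
            CQA.modifiedCQA (CQA.pauliZ n) (CQA.permOp n 2) 𝒯 v ∈ CQA.sOff (CQA.chargeBasis n r))
        (hC : ∀ v ∈ CQA.sector4 (CQA.chargeBasis n r),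
            CQA.cayley (CQA.pauliZ n) (CQA.permOp n 2) 𝒯 v ∈ CQA.sector4 (CQA.chargeBasis n r)),
        CQA.eig 1 ((CQA.modifiedCQA (CQA.pauliZ n) (CQA.permOp n 2) 𝒯).restrict hM) ≤
          CQA.eig 2 ((CQA.cayley (CQA.pauliZ n) (CQA.permOp n 2) 𝒯).restrict hC)) ∧
    -- `SU(d)` symmetry: `n` qudits, a copy of an irreducible representation of dimension at least two
    (∀ (n d : ℕ) (μ : YoungDiagram), Nontrivial (CQA.StandardTableau μ n) →
      ∀ e : CQA.StandardTableau μ n → EuclideanSpace ℂ (Fin n → Fin d), CQA.IsYoungBasis e →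
      ∀ 𝒯 : Finset (Equiv.Perm (Fin n)), (∀ τ ∈ 𝒯, τ.IsSwap) →
        Subgroup.closure (𝒯 : Set (Equiv.Perm (Fin n))) = ⊤ →
      ∃ (hM : ∀ v ∈ CQA.sOff e,
            CQA.modifiedCQA (CQA.yjm n d) (CQA.permOp n d) 𝒯 v ∈ CQA.sOff e)
        (hC : ∀ v ∈ CQA.sector4 e,
            CQA.cayley (CQA.yjm n d) (CQA.permOp n d) 𝒯 v ∈ CQA.sector4 e),
        CQA.eig 1 ((CQA.modifiedCQA (CQA.yjm n d) (CQA.permOp n d) 𝒯).restrict hM) ≤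
          CQA.eig 2 ((CQA.cayley (CQA.yjm n d) (CQA.permOp n d) 𝒯).restrict hC)) := by
  classical
  constructor
  · intro n r h0 hr 𝒯 hswap hgen
    have := CQA.nontrivial_chargeString h0 hr
    refine CQA.eig_modifiedCQA_le_eig_cayley
      (CQA.nonempty_of_closure_eq_top (by omega) hgen) (CQA.chargeBasis_orthonormal n r)
      (g := fun i x => CQA.bitSign (x.1 i)) CQA.toEuclideanLin_pauliZ_chargeBasis ?_
      (fun τ hτ => CQA.permOp_isHermitian_of_isSwap 2 (hswap τ hτ))
      (fun τ _ => CQA.permOp_map_conj n 2 τ)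
      (fun τ hτ => CQA.permOp_mul_self_of_isSwap 2 (hswap τ hτ)) ?_
    · intro x y h
      exact Subtype.ext (funext fun i => CQA.bitSign_injective (congrFun h i))
    · intro τ _ x
      rw [CQA.chargeBasis, CQA.toEuclideanLin_permOp_single]
      exact Submodule.subset_span ⟨x.perm τ⁻¹, rfl⟩
  · intro n d μ hnt e he 𝒯 hswap hgen
    have hn : 2 ≤ n := CQA.StandardTableau.two_le_of_nontrivial (μ := μ)
    -- The tableaux label a linearly independent family in a finite-dimensional space.
    have : Finite (CQA.StandardTableau μ n) := he.1.linearIndependent.finite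
    have := Fintype.ofFinite (CQA.StandardTableau μ n)
    exact CQA.eig_modifiedCQA_le_eig_cayley
      (CQA.nonempty_of_closure_eq_top hn hgen) he.1
      (g := fun i T => T.content i) he.yjm_apply CQA.StandardTableau.content_injective
      (fun τ hτ => CQA.permOp_isHermitian_of_isSwap d (hswap τ hτ))
      (fun τ _ => CQA.permOp_map_conj n d τ)
      (fun τ hτ => CQA.permOp_mul_self_of_isSwap d (hswap τ hτ))
      (fun τ _ T => he.perm_mem_span τ (Submodule.subset_span ⟨T, rfl⟩))
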